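/- For $\nu,\mu\in\mathbb C$ with $\mu+1\notin\{0,-1,-2,\dots\}$ and $x\in(-1,1)$ let $$\mathsf P_\nu^{-\mu}(x)=\frac1{\Gamma(\mu+1)}\left(\frac{1-x}{1+x}\right)^{\mu/2}{}_2F_1\!\left(-\nu,\nu+1;\mu+1;\tfrac{1-x}2\right)$$ be the Ferrers function of the first kind. Let $\mu\in\mathbb C$ with $2\mu+1\notin\{0,-1,-2,\dots\}$. Then $$\sum_{n=0}^\infty\frac{(\mu+n+\frac12)\,\Gamma(2\mu+n+1)}{n!}\,\mathsf P_{n+\mu}^{-\mu}(x)\,\mathsf P_{n+\mu}^{-\mu}(x')=\delta(x-x')$$ in the sense of distributions, both in the variable $x\in(-1,1)$ for every fixed $x'\in(-1,1)$, and in the two variables $(x,x')\in(-1,1)^2$ jointly. Explicitly, write $K_n(x,x')$ for the $n$-th term of the series. Each $K_n(\cdot,x')$ is locally integrable on $(-1,1)$, each $K_n$ is locally integrable on $(-1,1)^2$, and the following hold, each series being (unconditionally) convergent. (a) For every $x'\in(-1,1)$ and every $\varphi\in C_c^\infty((-1,1);\mathbb C)$, $$\sum_{n=0}^\infty\int_{-1}^1K_n(x,x')\,\varphi(x)\,dx=\varphi(x').$$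 (b) For every $\Phi\in C_c^\infty((-1,1)^2;\mathbb C)$, $$\sum_{n=0}^\infty\iint_{(-1,1)^2}K_n(x,x')\,\Phi(x,x')\,dx\,dx'=\int_{-1}^1\Phi(x,x)\,dx.$$ -/

import Mathlib

open Set MeasureTheory TopologicalSpace
open scoped Distributions

noncomputable section

/-- The Ferrers function of the first kind (associated Legendre function on the cut)
`P_ν^{-μ}(x)`, of degree `ν` and order `-μ`, for `x ∈ (-1, 1)`:
`P_ν^{-μ}(x) = 1 / Γ(μ+1) * ((1-x)/(1+x))^(μ/2) * ₂F₁(-ν, ν+1; μ+1; (1-x)/2)`.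
For `x ∈ (-1, 1)` the base of the power is a positive real number, so that the power is the
usual one, and `(1-x)/2 ∈ (0, 1)` lies in the disc of convergence of the Gauss series.
This form of the definition is meant for `μ + 1 ∉ {0, -1, -2, …}`. -/
def ferrersPNeg (ν μ : ℂ) (x : ℝ) : ℂ :=
  1 / Complex.Gamma (μ + 1) * (((1 - x) / (1 + x) : ℝ) : ℂ) ^ (μ / 2) *
    ordinaryHypergeometric (-ν) (ν + 1) (μ + 1) (((1 - x) / 2 : ℝ) : ℂ)

/-- The `n`-th term of the closure series,
`(μ + n + 1/2) Γ(2μ + n + 1) / n! * P_{n+μ}^{-μ}(x) * P_{n+μ}^{-μ}(x')`. -/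
def closureTerm (μ : ℂ) (n : ℕ) (x x' : ℝ) : ℂ :=
  (μ + n + 1 / 2) * Complex.Gamma (2 * μ + n + 1) / (n.factorial : ℂ) *
    ferrersPNeg (n + μ) μ x * ferrersPNeg (n + μ) μ x'

/-- The open interval `(-1, 1)`. -/
def openInterval11 : Opens ℝ := ⟨Ioo (-1) 1, isOpen_Ioo⟩

/-- The open square `(-1, 1) × (-1, 1)`. -/
def openSquare11 : Opens (ℝ × ℝ) := ⟨Ioo (-1) 1 ×ˢ Ioo (-1) 1, isOpen_Ioo.prod isOpen_Ioo⟩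

/-- The series `∑ f n` of functions on the open set `Ω` converges to the functional `T` in the
sense of distributions on `Ω`: every term is locally integrable on `Ω`, hence a regular
distribution, and for every complex test function `φ ∈ C_c^∞(Ω)` the series of the pairings
`∫_Ω f n * φ` converges to `T φ`. -/
def HasSumInDistributions {E : Type*} [NormedAddCommGroup E] [NormedSpace ℝ E]
    [MeasureSpace E] (Ω : Opens E) (f : ℕ → E → ℂ) (T : 𝓓(Ω, ℂ) → ℂ) : Prop :=
  (∀ n, LocallyIntegrableOn (f n) (Ω : Set E) volume) ∧
    ∀ φ : 𝓓(Ω, ℂ), HasSum (fun n : ℕ => ∫ x in (Ω : Set E), f n x * φ x) (T φ)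

/-- The Dirac distribution `δ(x - x')` in the variable `x ∈ (-1, 1)`, at the point `x'`. -/
def diracAt (x' : ℝ) (φ : 𝓓(openInterval11, ℂ)) : ℂ := φ x'

/-- The Dirac distribution `δ(x - x')` in both variables `(x, x') ∈ (-1, 1) × (-1, 1)`. -/
def diracDiagonal (Φ : 𝓓(openSquare11, ℂ)) : ℂ :=
  ∫ x in (openInterval11 : Set ℝ), Φ (x, x)

end

/-! Put l = μ + 1/2. Euler's transformation writes the hypergeometric factor of P_{n+μ}^{-μ}(x) as
((1+x)/2)^μ times a polynomial, so P_{n+μ}^{-μ}(x) is a constant times (1-x²)^{μ/2} C_n^l(x)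
(`ferrersPNeg_eq`), and the n-th term becomes κ_n C_n(x) C_n(x') (1-x²)^{μ/2} (1-x'²)^{μ/2}
(`closureTerm_eq`). With the powers absorbed into the test function, the claim is that a smooth f
with compact support in (-1,1) is the sum of its Gegenbauer series with respect to (1-x²)^{l-1/2}
(`hasExpansion`). For complex l this weight is neither positive nor always integrable, so Hilbert
space completeness is not available and the series is summed directly.

Convergence: the Gegenbauer operator is symmetric for the weight and C_n is an eigenvector with
eigenvalue -n(n+2l), so coefficients of smooth functions decay faster than any power of n
(`exists_decay`), while C_n is polynomially bounded on [-1,1] (`exists_bound`).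

Value: by Christoffel–Darboux the partial sums at y for (x-y)g(x) telescope to two boundary terms
that tend to 0 (`hasSum_sub_mul`). If Re l > 1/2, Hadamard's lemma gives f = f(y) + (x-y)g, and the
constant is its own expansion by a Beta integral. The remaining l are reached by descent from l+1 to
l: the derivative of the series of f is the series of f' for l+1, and the constant of integration is
found at a point outside the support (`HasExpansion.of_add_one`).

In two variables the expansion is applied to slices and integrated by dominated convergence, the
decay estimate being uniform over slices. -/

open Polynomial in
/-- The Gegenbauer polynomials `C_n^l`, by their three-term recurrence. -/
noncomputable def gegenbauer (l : ℂ) : ℕ → Polynomial ℂ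
  | 0 => 1
  | 1 => 2 * C l * X
  | n + 2 => C (1 / ((n : ℂ) + 2)) *
      (2 * ((n : ℂ[X]) + 1 + C l) * X * gegenbauer l (n + 1) -
        ((n : ℂ[X]) + 2 * C l) * gegenbauer l n)

/-! ### Algebraic identities for Gegenbauer polynomials -/

namespace Gegenbauer

section Algebra

open Polynomial

theorem recurrence (l : ℂ) (n : ℕ) :
    ((n : ℂ[X]) + 2) * gegenbauer l (n + 2) =
      2 * ((n : ℂ[X]) + 1 + C l) * X * gegenbauer l (n + 1) -
        ((n : ℂ[X]) + 2 * C l) * gegenbauer l n := by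
  have h : ((n : ℂ[X]) + 2) = C ((n : ℂ) + 2) := by simp [C_ofNat]
  have h2 : ((n : ℂ) + 2) ≠ 0 := by exact_mod_cast (by omega : n + 2 ≠ 0)
  rw [gegenbauer, ← mul_assoc, h, ← C_mul, mul_one_div_cancel h2, C_1, one_mul]

theorem natCast_add_ne_zero (n k : ℕ) : ((n : ℂ[X]) + (k + 1 : ℕ)) ≠ 0 := by
  exact_mod_cast (by omega : n + (k + 1) ≠ 0)

/-- The two relations are carried through one induction: the differentiated recurrence and the
second relation give the next first one, which in turn gives the next second one. -/
theorem derivative_relations (l : ℂ) (n : ℕ) :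
    ((n : ℂ[X]) + 2 * C l) * gegenbauer l n =
      derivative (gegenbauer l (n + 1)) - X * derivative (gegenbauer l n) ∧
    ((n : ℂ[X]) + 1) * gegenbauer l (n + 1) =
      X * derivative (gegenbauer l (n + 1)) - derivative (gegenbauer l n) := by
  induction n with
  | zero => simp [gegenbauer]; ring
  | succ n ih =>
    obtain ⟨hc, hb⟩ := ih
    have ha := recurrence l n
    have hd := congrArg derivative ha
    simp only [derivative_mul, derivative_add, derivative_sub, derivative_natCast,
      derivative_ofNat, derivative_C, derivative_X, derivative_one] at hd
    have h1 : ((n : ℂ[X]) + 1 + 2 * C l) * gegenbauer l (n + 1) =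
        derivative (gegenbauer l (n + 2)) - X * derivative (gegenbauer l (n + 1)) := by
      apply mul_left_cancel₀ (natCast_add_ne_zero n 1)
      push_cast
      linear_combination -hd + ((n : ℂ[X]) + 2 * C l) * hb
    refine ⟨?_, ?_⟩
    · push_cast; exact h1
    · push_cast
      linear_combination ha + X * h1 + X * hb - hc

/-- Eliminating one derivative from the two relations expresses (1 - X²) C' through the polynomials
themselves; one more differentiation gives the second-order equation. -/
theorem ode (l : ℂ) (n : ℕ) :
    (1 - X ^ 2) * derivative (derivative (gegenbauer l n)) -
      (2 * C l + 1) * X * derivative (gegenbauer l n) +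
      (n : ℂ[X]) * ((n : ℂ[X]) + 2 * C l) * gegenbauer l n = 0 := by
  cases n with
  | zero => simp [gegenbauer]
  | succ n =>
    obtain ⟨hc, hb⟩ := derivative_relations l n
    have hd : (1 - X ^ 2) * derivative (gegenbauer l (n + 1)) =
      ((n : ℂ[X]) + 2 * C l) * gegenbauer l n - ((n : ℂ[X]) + 1) * X * gegenbauer l (n + 1) := by
      linear_combination -hc + X * hb
    have h2 := congrArg derivative hd
    simp only [derivative_mul, derivative_add, derivative_sub, derivative_natCast,
      derivative_ofNat, derivative_C, derivative_X, derivative_one, derivative_pow] at h2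
    simp only [Nat.cast_ofNat, Nat.add_one_sub_one, pow_one, C_ofNat] at h2
    push_cast
    linear_combination h2 + ((n : ℂ[X]) + 2 * C l) * hb

/-- By the derivative relations the derivatives satisfy, up to the factor 2l, the recurrence of
parameter l + 1. -/
theorem derivative_eq (l : ℂ) (n : ℕ) :
    derivative (gegenbauer l (n + 1)) = 2 * C l * gegenbauer (l + 1) n := by
  induction n using Nat.twoStepInduction with
  | zero => simp [gegenbauer]
  | one =>
    have h := congrArg derivative (recurrence l 0)
    simp [gegenbauer] at h
    apply mul_left_cancel₀ (two_ne_zero (α := ℂ[X]))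
    simp [gegenbauer]
    have hC : (C (2⁻¹ : ℂ) : ℂ[X]) * 2 = 1 := by
      rw [← C_ofNat, ← C_mul]; simp
    linear_combination h - 4 * C l * (1 + C l) * X * hC
  | more n h0 h1 =>
    obtain ⟨hc, -⟩ := derivative_relations l (n + 2)
    obtain ⟨-, hb⟩ := derivative_relations l (n + 1)
    apply mul_left_cancel₀ (natCast_add_ne_zero n 1)
    have ha := recurrence (l + 1) n
    rw [C_add, C_1] at ha
    push_cast at hc hb ⊢
    linear_combination 2 * C l * -ha - ((n : ℂ[X]) + 2) * hc
      + ((n : ℂ[X]) + 2 + 2 * C l) * hb + 2 * ((n : ℂ[X]) + 2 + C l) * X * h1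
      - ((n : ℂ[X]) + 2 + 2 * C l) * h0

theorem eval_one (l : ℂ) (n : ℕ) :
    ((n : ℂ) + 1) * (gegenbauer l (n + 1)).eval 1 =
      ((n : ℂ) + 2 * l) * (gegenbauer l n).eval 1 := by
  induction n with
  | zero => simp [gegenbauer]
  | succ n ih =>
    have ha := congrArg (eval 1) (recurrence l n)
    simp at ha
    push_cast
    linear_combination ha + ih

end Algebra

/-- The sequence `n! / (2l)_n`. -/
noncomputable def invEvalOne (l : ℂ) : ℕ → ℂ
  | 0 => 1
  | n + 1 => invEvalOne l n * ((n : ℂ) + 1) / ((n : ℂ) + 2 * l)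

/-- `2l` is not a nonpositive integer. -/
def Regular (l : ℂ) : Prop := ∀ n : ℕ, (n : ℂ) + 2 * l ≠ 0

variable {l : ℂ}

theorem invEvalOne_succ (hl : Regular l) (n : ℕ) :
    invEvalOne l (n + 1) * ((n : ℂ) + 2 * l) = invEvalOne l n * ((n : ℂ) + 1) := by
  rw [invEvalOne, div_mul_cancel₀ _ (hl n)]

theorem invEvalOne_mul_eval_one (hl : Regular l) (n : ℕ) :
    invEvalOne l n * (gegenbauer l n).eval 1 = 1 := by
  induction n with
  | zero => simp [invEvalOne, gegenbauer]
  | succ n ih =>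
    apply mul_left_cancel₀ (hl n)
    have h := eval_one l n
    have h2 := invEvalOne_succ hl n
    linear_combination (gegenbauer l (n + 1)).eval 1 * h2 + invEvalOne l n * h +
      ((n : ℂ) + 2 * l) * ih

theorem Regular.add_one (hl : Regular l) : Regular (l + 1) := fun n => by
  have := hl (n + 2)
  push_cast at this
  intro h
  apply this
  linear_combination h

theorem Regular.natCast_add_ne_zero (hl : Regular l) (n : ℕ) : (n : ℂ) + l ≠ 0 := fun h => by
  have := hl (2 * n)
  push_cast at this
  apply this
  linear_combination 2 * h

/-- The factor n!/(2l)_n symmetrizes the three-term recurrence. Cross-multiplying the recurrences at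
x and y then makes the sum telescope. -/
theorem christoffel_darboux (hl : Regular l) (N : ℕ) (x y : ℂ) :
    2 * (x - y) * ∑ n ∈ Finset.range (N + 1), ((n : ℂ) + l) * invEvalOne l n *
        (gegenbauer l n).eval x * (gegenbauer l n).eval y =
      invEvalOne l N * ((N : ℂ) + 1) *
        ((gegenbauer l (N + 1)).eval x * (gegenbauer l N).eval y -
          (gegenbauer l N).eval x * (gegenbauer l (N + 1)).eval y) := by
  induction N with
  | zero => simp [gegenbauer, invEvalOne]; ring
  | succ N ih =>
    rw [Finset.sum_range_succ, mul_add, ih]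
    have hx := congrArg (Polynomial.eval x) (recurrence l N)
    have hy := congrArg (Polynomial.eval y) (recurrence l N)
    simp at hx hy
    have h := invEvalOne_succ hl N
    push_cast
    linear_combination
      -invEvalOne l (N + 1) * (gegenbauer l (N + 1)).eval y * hx +
      invEvalOne l (N + 1) * (gegenbauer l (N + 1)).eval x * hy -
      ((gegenbauer l (N + 1)).eval x * (gegenbauer l N).eval y -
          (gegenbauer l N).eval x * (gegenbauer l (N + 1)).eval y) * h

end Gegenbauer

/-! ### Sequences of polynomial growth -/

/-- A real sequence bounded above by a polynomial. -/
def PolyBounded (a : ℕ → ℝ) : Prop :=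
  ∃ (C : ℝ) (M : ℕ), 0 ≤ C ∧ ∀ n, a n ≤ C * ((n : ℝ) + 1) ^ M

namespace PolyBounded

theorem mono {a b : ℕ → ℝ} (hb : PolyBounded b) (h : ∀ n, a n ≤ b n) : PolyBounded a := by
  obtain ⟨C, M, hC, hb⟩ := hb
  exact ⟨C, M, hC, fun n => (h n).trans (hb n)⟩

theorem const {c : ℝ} (hc : 0 ≤ c) : PolyBounded (fun _ => c) := ⟨c, 0, hc, fun n => by simp⟩

theorem natCast_add_one : PolyBounded (fun n => (n : ℝ) + 1) := ⟨1, 1, by simp, fun n => by simp⟩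

theorem mul {a b : ℕ → ℝ} (ha : PolyBounded a) (hb : PolyBounded b) (hb0 : ∀ n, 0 ≤ b n) :
    PolyBounded (fun n => a n * b n) := by
  obtain ⟨C, M, hC, ha⟩ := ha
  obtain ⟨D, N, hD, hb⟩ := hb
  refine ⟨C * D, M + N, by positivity, fun n => ?_⟩
  calc a n * b n ≤ (C * ((n : ℝ) + 1) ^ M) * (D * ((n : ℝ) + 1) ^ N) :=
        mul_le_mul (ha n) (hb n) (hb0 n) (by positivity)
    _ = _ := by ring

theorem succ {a : ℕ → ℝ} (ha : PolyBounded a) : PolyBounded (fun n => a (n + 1)) := by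
  obtain ⟨C, M, hC, ha⟩ := ha
  refine ⟨C * 2 ^ M, M, by positivity, fun n => (ha (n + 1)).trans ?_⟩
  rw [mul_assoc, ← mul_pow]
  gcongr
  push_cast
  have : (0 : ℝ) ≤ n := n.cast_nonneg
  linarith

theorem sum_antidiagonal {a b : ℕ → ℝ} (ha : PolyBounded a) (hb : PolyBounded b)
    (hb0 : ∀ n, 0 ≤ b n) :
    PolyBounded (fun n => ∑ p ∈ Finset.HasAntidiagonal.antidiagonal n, a p.1 * b p.2) := by
  obtain ⟨C, M, hC, ha⟩ := ha
  obtain ⟨D, N, hD, hb⟩ := hb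
  refine ⟨C * D, M + N + 1, by positivity, fun n => ?_⟩
  have h : ∀ p ∈ Finset.HasAntidiagonal.antidiagonal n,
      a p.1 * b p.2 ≤ C * D * ((n : ℝ) + 1) ^ (M + N) := by
    intro p hp
    have hp := Finset.HasAntidiagonal.mem_antidiagonal.1 hp
    have h1 : (p.1 : ℝ) ≤ n := by exact_mod_cast (by omega : p.1 ≤ n)
    have h2 : (p.2 : ℝ) ≤ n := by exact_mod_cast (by omega : p.2 ≤ n)
    calc a p.1 * b p.2 ≤ (C * ((p.1 : ℝ) + 1) ^ M) * (D * ((p.2 : ℝ) + 1) ^ N) :=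
          mul_le_mul (ha _) (hb _) (hb0 _) (by positivity)
      _ ≤ (C * ((n : ℝ) + 1) ^ M) * (D * ((n : ℝ) + 1) ^ N) := by gcongr
      _ = _ := by ring
  refine (Finset.sum_le_card_nsmul _ _ _ h).trans (le_of_eq ?_)
  rw [Finset.Nat.card_antidiagonal, nsmul_eq_mul]
  push_cast
  ring

end PolyBounded

theorem exists_natCast_add_one_le {b : ℂ} (hb : ∀ n : ℕ, (n : ℂ) + b ≠ 0) :
    ∃ c : ℝ, 0 ≤ c ∧ ∀ n : ℕ, (n : ℝ) + 1 ≤ c * ‖(n : ℂ) + b‖ := by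
  -- For n ≥ 2‖b‖ + 1 one has n + 1 ≤ 2(n - ‖b‖), so the constant 2 suffices; the finitely many
  -- smaller n are covered by adding all their ratios.
  obtain ⟨N, hN⟩ := exists_nat_ge (2 * ‖b‖ + 1)
  have hpos : ∀ k : ℕ, 0 < ‖(k : ℂ) + b‖ := fun k => norm_pos_iff.2 (hb k)
  have hnn : ∀ k ∈ Finset.range N, 0 ≤ ((k : ℝ) + 1) / ‖(k : ℂ) + b‖ := fun k _ => by
    have := hpos k; positivity
  refine ⟨2 + ∑ k ∈ Finset.range N, ((k : ℝ) + 1) / ‖(k : ℂ) + b‖,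
    add_nonneg two_pos.le (Finset.sum_nonneg hnn), fun n => ?_⟩
  rcases lt_or_ge n N with h | h
  · rw [← div_le_iff₀ (hpos n)]
    have := Finset.single_le_sum hnn (Finset.mem_range.2 h)
    linarith
  · have h1 : (n : ℝ) ≤ ‖(n : ℂ) + b‖ + ‖b‖ := by
      have := norm_sub_le ((n : ℂ) + b) b
      simpa using this
    have h2 : (N : ℝ) ≤ n := by exact_mod_cast h
    have h3 := mul_nonneg (Finset.sum_nonneg hnn) (hpos n).le
    nlinarith

/-- A sequence whose consecutive ratios are `(n + a) / (n + b)` grows at most polynomially. -/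
theorem PolyBounded.of_ratio {s : ℕ → ℂ} {a b : ℂ} (hb : ∀ n : ℕ, (n : ℂ) + b ≠ 0)
    (hs : ∀ n : ℕ, s (n + 1) * ((n : ℂ) + b) = s n * ((n : ℂ) + a)) :
    PolyBounded (fun n => ‖s n‖) := by
  obtain ⟨c, hc, h⟩ := exists_natCast_add_one_le hb
  -- With this M the ratio is at most 1 + M/(n+1) ≤ ((n+2)/(n+1))^M by Bernoulli, and the product of
  -- these bounds telescopes.
  obtain ⟨M, hM⟩ := exists_nat_ge (‖a - b‖ * c)
  refine ⟨‖s 0‖, M, norm_nonneg _, fun n => ?_⟩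
  induction n with
  | zero => simp
  | succ n ih =>
    have hpos : 0 < ‖(n : ℂ) + b‖ := norm_pos_iff.2 (hb n)
    have hn : (0 : ℝ) < (n : ℝ) + 1 := by positivity
    have h1 : ‖(n : ℂ) + a‖ ≤ ‖(n : ℂ) + b‖ * (1 + M * ((n : ℝ) + 1)⁻¹) := by
      have h2 : ‖(n : ℂ) + a‖ ≤ ‖(n : ℂ) + b‖ + ‖a - b‖ := by
        have := norm_add_le ((n : ℂ) + b) (a - b)
        ring_nf at this ⊢
        exact this
      have h3 : ‖a - b‖ * ((n : ℝ) + 1) ≤ M * ‖(n : ℂ) + b‖ :=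
        calc ‖a - b‖ * ((n : ℝ) + 1) ≤ ‖a - b‖ * (c * ‖(n : ℂ) + b‖) := by
              gcongr; exact h n
          _ = ‖a - b‖ * c * ‖(n : ℂ) + b‖ := by ring
          _ ≤ _ := by gcongr
      have h4 : ‖a - b‖ ≤ M * ‖(n : ℂ) + b‖ * ((n : ℝ) + 1)⁻¹ := by
        rw [← div_eq_mul_inv, le_div_iff₀ hn]; exact h3
      linarith
    have h5 : (1 + M * ((n : ℝ) + 1)⁻¹) ≤ (1 + ((n : ℝ) + 1)⁻¹) ^ M :=
      one_add_mul_le_pow (by have : 0 < ((n : ℝ) + 1)⁻¹ := by positivity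
                             linarith) M
    have h6 : ‖s (n + 1)‖ * ‖(n : ℂ) + b‖ = ‖s n‖ * ‖(n : ℂ) + a‖ := by
      rw [← norm_mul, hs, norm_mul]
    have h7 : ‖s (n + 1)‖ * ‖(n : ℂ) + b‖ ≤
        (‖s 0‖ * ((n + 1 : ℕ) + 1 : ℝ) ^ M) * ‖(n : ℂ) + b‖ := by
      rw [h6]
      calc ‖s n‖ * ‖(n : ℂ) + a‖
          ≤ (‖s 0‖ * ((n : ℝ) + 1) ^ M) *
            (‖(n : ℂ) + b‖ * (1 + ((n : ℝ) + 1)⁻¹) ^ M) := by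
              gcongr
              exact h1.trans (by gcongr)
        _ = (‖s 0‖ * (((n : ℝ) + 1) * (1 + ((n : ℝ) + 1)⁻¹)) ^ M) * ‖(n : ℂ) + b‖ := by
              rw [mul_pow]; ring
        _ = _ := by
              rw [mul_add, mul_inv_cancel₀ hn.ne']; push_cast; ring
    exact le_of_mul_le_mul_right h7 hpos

/-! ### The generating function and a polynomial bound on [-1,1] -/

namespace Gegenbauer

/-- The coefficients `(l)_n / n!` of `(1 - z) ^ (-l)`. -/
noncomputable def binomCoeff (l : ℂ) : ℕ → ℂ
  | 0 => 1
  | n + 1 => binomCoeff l n * ((n : ℂ) + l) / ((n : ℂ) + 1)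

theorem binomCoeff_succ (l : ℂ) (n : ℕ) :
    binomCoeff l (n + 1) * ((n : ℂ) + 1) = binomCoeff l n * ((n : ℂ) + l) := by
  rw [binomCoeff, div_mul_cancel₀ _ (Nat.cast_add_one_ne_zero n)]

theorem polyBounded_binomCoeff (l : ℂ) : PolyBounded (fun n => ‖binomCoeff l n‖) :=
  PolyBounded.of_ratio (fun n => Nat.cast_add_one_ne_zero n) (binomCoeff_succ l)

-- The differential equation of (1 - tz)^(-l), which makes formal manipulation of such powers
-- possible.
open PowerSeries in
theorem derivative_binomCoeff (l t : ℂ) :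
    (1 - C t * X) * d⁄dX ℂ (mk fun n => binomCoeff l n * t ^ n) =
      C (l * t) * mk fun n => binomCoeff l n * t ^ n := by
  ext n
  rw [sub_mul, one_mul, map_sub, mul_assoc, coeff_C_mul, coeff_C_mul, coeff_mk, coeff_derivative,
    coeff_mk]
  cases n with
  | zero =>
    have := binomCoeff_succ l 0
    simp at this
    simp [this]
    ring
  | succ n =>
    rw [coeff_succ_X_mul, coeff_derivative, coeff_mk]
    have := binomCoeff_succ l (n + 1)
    push_cast at this ⊢
    linear_combination t ^ (n + 2) * this

/-- For ab = 1 the product (1 - az)^(-l) (1 - bz)^(-l) is the generating function (1 - 2xz +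
z²)^(-l) with x = (a+b)/2. Its differential equation, read on coefficients, is the Gegenbauer
recurrence. -/
theorem eval_eq_sum_antidiagonal (l : ℂ) {a b : ℂ} (hab : a * b = 1) (n : ℕ) :
    (gegenbauer l n).eval ((a + b) / 2) =
      ∑ p ∈ Finset.HasAntidiagonal.antidiagonal n,
        (binomCoeff l p.1 * a ^ p.1) * (binomCoeff l p.2 * b ^ p.2) := by
  set A : PowerSeries ℂ := PowerSeries.mk fun n => binomCoeff l n * a ^ n with hA
  set B : PowerSeries ℂ := PowerSeries.mk fun n => binomCoeff l n * b ^ n with hB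
  have hA' := derivative_binomCoeff l a
  have hB' := derivative_binomCoeff l b
  rw [← hA] at hA'
  rw [← hB] at hB'
  have hF : (1 - PowerSeries.C (a + b) * PowerSeries.X + PowerSeries.X ^ 2) *
      PowerSeries.derivative ℂ (A * B) =
      PowerSeries.C l * (PowerSeries.C (a + b) - 2 * PowerSeries.X) * (A * B) := by
    have hC : PowerSeries.C a * PowerSeries.C b = 1 := by rw [← map_mul, hab, map_one]
    rw [Derivation.leibniz, smul_eq_mul, smul_eq_mul]
    rw [map_mul] at hA' hB'
    rw [map_add]
    linear_combination (1 - PowerSeries.C b * PowerSeries.X) * B * hA' +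
      (1 - PowerSeries.C a * PowerSeries.X) * A * hB' -
      (PowerSeries.X ^ 2 * (A * PowerSeries.derivative ℂ B + B * PowerSeries.derivative ℂ A) +
        2 * PowerSeries.C l * PowerSeries.X * A * B) * hC
  set f : ℕ → ℂ := fun n => PowerSeries.coeff n (A * B) with hf
  have hfsum : ∀ n, f n = ∑ p ∈ Finset.HasAntidiagonal.antidiagonal n,
      (binomCoeff l p.1 * a ^ p.1) * (binomCoeff l p.2 * b ^ p.2) := fun n => by
    simp [hf, hA, hB, PowerSeries.coeff_mul]
  have hrec : ∀ n : ℕ, ((n : ℂ) + 2) * f (n + 2) =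
      ((n : ℂ) + 1 + l) * (a + b) * f (n + 1) - ((n : ℂ) + 2 * l) * f n := fun n => by
    have h := congrArg (PowerSeries.coeff (n + 1)) hF
    rw [add_mul, sub_mul, one_mul, pow_two, mul_assoc, mul_assoc, map_add, map_sub,
      PowerSeries.coeff_C_mul, PowerSeries.coeff_succ_X_mul, PowerSeries.coeff_succ_X_mul,
      mul_assoc (PowerSeries.C l), PowerSeries.coeff_C_mul, sub_mul, map_sub,
      PowerSeries.coeff_C_mul, mul_assoc 2, ← map_ofNat (PowerSeries.C (R := ℂ)),
      PowerSeries.coeff_C_mul, PowerSeries.coeff_succ_X_mul, PowerSeries.coeff_derivative,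
      PowerSeries.coeff_derivative] at h
    cases n with
    | zero =>
      rw [PowerSeries.coeff_zero_X_mul] at h
      simp only [hf]
      push_cast at h ⊢
      linear_combination h
    | succ n =>
      rw [PowerSeries.coeff_succ_X_mul, PowerSeries.coeff_derivative] at h
      simp only [hf]
      push_cast at h ⊢
      linear_combination h
  rw [← hfsum]
  induction n using Nat.twoStepInduction with
  | zero => simp [hfsum, gegenbauer, binomCoeff]
  | one => simp [hfsum, gegenbauer, binomCoeff, Finset.Nat.antidiagonal_succ]
           ring
  | more n h0 h1 =>
    have h2 : ((n : ℂ) + 2) ≠ 0 := by exact_mod_cast (by omega : n + 2 ≠ 0)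
    apply mul_left_cancel₀ h2
    have ha := congrArg (Polynomial.eval ((a + b) / 2)) (recurrence l n)
    simp at ha
    rw [ha, hrec, h0, h1]
    ring

/-- With x = cos t one takes a = e^{it} and b = e^{-it}. Both have modulus 1, so the triangle
inequality leaves a convolution of polynomially bounded sequences, independent of x. -/
theorem exists_bound (l : ℂ) : ∃ B : ℕ → ℝ, PolyBounded B ∧ (∀ n, 0 ≤ B n) ∧
    ∀ n, ∀ x ∈ Icc (-1 : ℝ) 1, ‖(gegenbauer l n).eval (x : ℂ)‖ ≤ B n := by
  refine ⟨_, PolyBounded.sum_antidiagonal (polyBounded_binomCoeff l) (polyBounded_binomCoeff l)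
    (fun n => norm_nonneg _), fun n => by positivity, fun n x hx => ?_⟩
  set t := Real.arccos x
  have hx : (x : ℂ) = (Complex.exp (t * Complex.I) + Complex.exp (-t * Complex.I)) / 2 := by
    rw [← Complex.cos, ← Complex.ofReal_cos, Real.cos_arccos hx.1 hx.2]
  rw [hx, eval_eq_sum_antidiagonal l (by rw [← Complex.exp_add]; simp)]
  refine (norm_sum_le _ _).trans (le_of_eq (Finset.sum_congr rfl fun p _ => ?_))
  have h2 : ‖Complex.exp (-t * Complex.I)‖ = 1 := by
    have := Complex.norm_exp_ofReal_mul_I (-t)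
    push_cast at this
    exact this
  simp only [norm_mul, norm_pow, h2, Complex.norm_exp_ofReal_mul_I, one_pow, mul_one]

end Gegenbauer

/-! ### Hypergeometric functions as Gegenbauer polynomials -/

namespace Gegenbauer

theorem choose_succ_mul (a : ℂ) (k : ℕ) :
    Ring.choose a (k + 1) * ((k : ℂ) + 1) = Ring.choose a k * (a - k) := by
  have h (k : ℕ) : (descPochhammer ℤ k).smeval a = (k.factorial : ℂ) * Ring.choose a k := by
    rw [Ring.descPochhammer_eq_factorial_smul_choose, nsmul_eq_mul]
  have h1 := h (k + 1)
  rw [descPochhammer_succ_right, Polynomial.smeval_mul, h k, Nat.factorial_succ] at h1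
  simp [Polynomial.smeval_natCast] at h1
  apply mul_left_cancel₀ (Nat.cast_ne_zero.2 k.factorial_ne_zero : (k.factorial : ℂ) ≠ 0)
  linear_combination -h1

theorem binomCoeff_neg (a : ℂ) (k : ℕ) : binomCoeff (-a) k = (-1) ^ k * Ring.choose a k := by
  induction k with
  | zero => simp [binomCoeff]
  | succ k ih =>
    apply mul_right_cancel₀ (Nat.cast_add_one_ne_zero k : (k : ℂ) + 1 ≠ 0)
    rw [binomCoeff_succ, ih, mul_assoc _ _ ((k : ℂ) + 1), choose_succ_mul]
    ring

theorem hasSum_binomCoeff (a : ℂ) {z : ℂ} (hz : ‖z‖ < 1) :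
    HasSum (fun k => binomCoeff (-a) k * z ^ k) ((1 - z) ^ a) := by
  have h := (Complex.one_add_cpow_hasFPowerSeriesOnBall_zero (a := a)).hasSum (y := -z)
    (by simpa [Metric.mem_eball, edist_eq_enorm_sub, enorm_eq_nnnorm, ← NNReal.coe_lt_one] using hz)
  have h1 : (1 - z) ^ a = (1 + (0 + -z)) ^ a := by rw [zero_add, sub_eq_add_neg]
  rw [h1]
  refine h.congr_fun fun k => ?_
  rw [binomCoeff_neg, binomialSeries, FormalMultilinearSeries.ofScalars_apply_eq, neg_pow z,
    smul_eq_mul]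
  ring

theorem summable_norm_binomCoeff (a : ℂ) {z : ℂ} (hz : ‖z‖ < 1) :
    Summable (fun k => ‖binomCoeff (-a) k * z ^ k‖) :=
  (hasSum_binomCoeff a hz).summable.norm

/-- The polynomial `z ↦ C_n^l (1 - 2 z)`. -/
noncomputable def shifted (l : ℂ) (n : ℕ) : Polynomial ℂ :=
  (gegenbauer l n).comp (1 - 2 * Polynomial.X)

-- Under x = 1 - 2z the Gegenbauer equation becomes the hypergeometric one with parameters -n, n +
-- 2l, l + 1/2.
open Polynomial in
theorem shifted_ode (l : ℂ) (n : ℕ) :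
    X * (1 - X) * derivative (derivative (shifted l n)) +
      (C l + C (1 / 2)) * (1 - 2 * X) * derivative (shifted l n) +
      (n : ℂ[X]) * ((n : ℂ[X]) + 2 * C l) * shifted l n = 0 := by
  have h := congrArg (fun p : Polynomial ℂ => p.comp (1 - 2 * Polynomial.X)) (ode l n)
  have hC : (C (1 / 2 : ℂ) : ℂ[X]) * 2 = 1 := by
    rw [← C_ofNat, ← C_mul]; simp
  have h1 : derivative (1 - 2 * X : ℂ[X]) = -2 := by simp
  have h2 : derivative (shifted l n) =
      -2 * (derivative (gegenbauer l n)).comp (1 - 2 * X) := by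
    rw [shifted, derivative_comp, h1]
  have h3 : derivative (derivative (shifted l n)) =
      4 * (derivative (derivative (gegenbauer l n))).comp (1 - 2 * X) := by
    rw [h2, derivative_mul, derivative_comp, h1]
    simp
    ring
  rw [h3, h2, shifted]
  simp only [sub_comp, add_comp, mul_comp, pow_comp, X_comp, C_comp, one_comp, zero_comp,
    natCast_comp, ofNat_comp, Nat.cast_ofNat] at h
  linear_combination h - (1 - 2 * X) * (derivative (gegenbauer l n)).comp (1 - 2 * X) * hC

open PowerSeries in
/-- If `P` solves the hypergeometric equation with parameters `-n`, `n + 2 m + 1`, `m + 1`, then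
`(1 - z) ^ m P` solves the one with parameters `-n - m`, `n + m + 1`, `m + 1`. -/
theorem mul_binomial_ode (m : ℂ) (n : ℕ) {B P : PowerSeries ℂ}
    (hB : (1 - X) * d⁄dX ℂ B = C (-m) * B)
    (hP : X * (1 - X) * d⁄dX ℂ (d⁄dX ℂ P) + (C m + 1) * (1 - 2 * X) * d⁄dX ℂ P +
      C (n : ℂ) * (C (n : ℂ) + 2 * C m + 1) * P = 0) :
    X * (1 - X) * d⁄dX ℂ (d⁄dX ℂ (B * P)) + (C m + 1 - 2 * X) * d⁄dX ℂ (B * P) +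
      (C (n : ℂ) + C m) * (C (n : ℂ) + C m + 1) * (B * P) = 0 := by
  have hB2 := congrArg (d⁄dX ℂ) hB
  simp only [Derivation.leibniz, smul_eq_mul, map_sub, Derivation.map_one_eq_zero,
    PowerSeries.derivative_X, PowerSeries.derivative_C] at hB2
  simp only [Derivation.leibniz, smul_eq_mul, map_add]
  rw [map_neg] at hB hB2
  -- The derivatives of B are known only after multiplication by powers of 1 - X, so the identity is
  -- proved times 1 - X, which can then be cancelled.
  have h1 : (1 - X : PowerSeries ℂ) ≠ 0 := fun h => by
    have := congrArg (PowerSeries.coeff 0) h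
    simp at this
  apply mul_left_cancel₀ h1
  linear_combination X * (1 - X) * P * hB2 +
    (X * P + 2 * X * (1 - X) * d⁄dX ℂ P + (C m + 1 - 2 * X) * P - C m * X * P) * hB +
    (1 - X) * B * hP

open PowerSeries in
theorem coeff_recurrence {a b c : ℂ} {H : PowerSeries ℂ}
    (hH : X * (1 - X) * d⁄dX ℂ (d⁄dX ℂ H) + (C c - C (a + b + 1) * X) * d⁄dX ℂ H -
      C (a * b) * H = 0) (k : ℕ) :
    ((k : ℂ) + 1) * (k + c) * coeff (k + 1) H = (k + a) * (k + b) * coeff k H := by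
  have h := congrArg (coeff k) hH
  have e : X * (1 - X) * d⁄dX ℂ (d⁄dX ℂ H) =
    X * d⁄dX ℂ (d⁄dX ℂ H) - X * (X * d⁄dX ℂ (d⁄dX ℂ H)) := by ring
  rw [e, sub_mul, mul_assoc, map_sub, map_add, map_sub, map_sub, map_zero, coeff_C_mul,
    coeff_C_mul, coeff_C_mul] at h
  rcases k with _ | _ | k
  · simp [coeff_zero_X_mul, coeff_derivative] at h ⊢
    linear_combination h
  · simp [coeff_zero_X_mul, coeff_succ_X_mul, coeff_derivative] at h ⊢
    linear_combination h
  · simp only [coeff_succ_X_mul, coeff_derivative] at h ⊢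
    push_cast at h ⊢
    linear_combination h

/-- Since k + c never vanishes, the first-order recurrence has only one solution with initial value
1, and the Gauss coefficients are one. -/
theorem hypergeometric_coeff {a b c : ℂ} (hc : ∀ k : ℕ, (k : ℂ) + c ≠ 0) {h : ℕ → ℂ}
    (h0 : h 0 = 1)
    (hh : ∀ k : ℕ, ((k : ℂ) + 1) * (k + c) * h (k + 1) = (k + a) * (k + b) * h k) (k : ℕ) :
    ((k.factorial : ℂ)⁻¹ * (ascPochhammer ℂ k).eval a * (ascPochhammer ℂ k).eval b *
      ((ascPochhammer ℂ k).eval c)⁻¹) = h k := by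
  induction k with
  | zero => simp [h0]
  | succ k ih =>
    have h1 : ((k : ℂ) + 1) ≠ 0 := Nat.cast_add_one_ne_zero k
    apply mul_left_cancel₀ (mul_ne_zero h1 (hc k))
    rw [hh, ← ih, ascPochhammer_succ_eval, ascPochhammer_succ_eval, ascPochhammer_succ_eval,
      Nat.factorial_succ]
    have h2 := hc k
    rw [add_comm] at h2
    push_cast
    rw [mul_inv, mul_inv, add_comm (k : ℂ) c, add_comm (k : ℂ) a, add_comm (k : ℂ) b]
    field_simp

/-- Euler's transformation. The formal product of the series of (1 - z)^m and the normalized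
polynomial solves the hypergeometric equation with constant term 1, hence has the Gauss
coefficients; for ‖z‖ < 1 the Cauchy product of absolutely convergent series turns this into an
identity of values. -/
theorem hypergeometric_eq {m : ℂ} (hm : ∀ k : ℕ, (k : ℂ) + (m + 1) ≠ 0)
    (hl : Regular (m + 1 / 2)) (n : ℕ) {z : ℂ} (hz : ‖z‖ < 1) :
    ordinaryHypergeometric (-((n : ℂ) + m)) (n + m + 1) (m + 1) z =
      (1 - z) ^ m * (invEvalOne (m + 1 / 2) n * (gegenbauer (m + 1 / 2) n).eval (1 - 2 * z)) := by
  set l := m + 1 / 2 with hldef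
  set B : PowerSeries ℂ := PowerSeries.mk (binomCoeff (-m)) with hBdef
  set p : Polynomial ℂ := Polynomial.C (invEvalOne l n) * shifted l n with hp
  have hB : (1 - PowerSeries.X) * PowerSeries.derivative ℂ B = PowerSeries.C (-m) * B := by
    simpa using derivative_binomCoeff (-m) 1
  have hP : PowerSeries.X * (1 - PowerSeries.X) *
      PowerSeries.derivative ℂ (PowerSeries.derivative ℂ (p : PowerSeries ℂ)) +
      (PowerSeries.C m + 1) * (1 - 2 * PowerSeries.X) *
      PowerSeries.derivative ℂ (p : PowerSeries ℂ) +
      PowerSeries.C (n : ℂ) * (PowerSeries.C (n : ℂ) + 2 * PowerSeries.C m + 1) *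
      (p : PowerSeries ℂ) = 0 := by
    have hC : (Polynomial.C (1 / 2 : ℂ)) * 2 = 1 := by
      rw [← Polynomial.C_ofNat, ← Polynomial.C_mul]; simp
    have h1 : Polynomial.X * (1 - Polynomial.X) * Polynomial.derivative (Polynomial.derivative p) +
      (Polynomial.C m + 1) * (1 - 2 * Polynomial.X) * Polynomial.derivative p +
      Polynomial.C (n : ℂ) * (Polynomial.C (n : ℂ) + 2 * Polynomial.C m + 1) * p = 0 := by
      have h := shifted_ode l n
      rw [hldef, Polynomial.C_add, ← hldef] at h
      rw [hp, Polynomial.derivative_C_mul, Polynomial.derivative_C_mul, map_natCast Polynomial.C]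
      linear_combination Polynomial.C (invEvalOne l n) * h - (Polynomial.C (invEvalOne l n) *
        ((1 - 2 * Polynomial.X) * Polynomial.derivative (shifted l n) + n * shifted l n)) * hC
    have h2 := congrArg (fun q : Polynomial ℂ => (q : PowerSeries ℂ)) h1
    have hsub (q r : Polynomial ℂ) : ((q - r : Polynomial ℂ) : PowerSeries ℂ) = q - r :=
      map_sub (Polynomial.coeToPowerSeries.ringHom (R := ℂ)) q r
    have htwo : ((2 : Polynomial ℂ) : PowerSeries ℂ) = 2 :=
      map_ofNat (Polynomial.coeToPowerSeries.ringHom (R := ℂ)) 2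
    simp only [Polynomial.coe_add, Polynomial.coe_mul, hsub, Polynomial.coe_one, htwo,
      Polynomial.coe_X, Polynomial.coe_C, Polynomial.coe_zero] at h2
    rw [PowerSeries.derivative_coe, PowerSeries.derivative_coe]
    exact h2
  have hH := mul_binomial_ode m n hB hP
  have hrec := coeff_recurrence (a := -((n : ℂ) + m)) (b := n + m + 1) (c := m + 1)
    (H := B * (p : PowerSeries ℂ)) (by
      simp only [map_add, map_neg, map_mul, map_one]
      linear_combination hH)
  have h0 : PowerSeries.coeff 0 (B * (p : PowerSeries ℂ)) = 1 := by
    have h1 := invEvalOne_mul_eval_one hl n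
    simp [hBdef, hp, binomCoeff, shifted,
      Polynomial.coeff_zero_eq_eval_zero, Polynomial.eval_comp]
    simpa using h1
  have hps : HasSum (fun k => p.coeff k * z ^ k) (p.eval z) := by
    rw [Polynomial.eval_eq_sum_range]
    exact hasSum_sum_of_ne_finset_zero fun k hk => by
      rw [Polynomial.coeff_eq_zero_of_natDegree_lt (by simpa using hk), zero_mul]
  rw [ordinaryHypergeometric_eq_tsum]
  simp only [hypergeometric_coeff (h := fun k => PowerSeries.coeff k (B * (p : PowerSeries ℂ)))
    hm h0 hrec, smul_eq_mul]
  have h2 : p.eval z = invEvalOne l n * (gegenbauer l n).eval (1 - 2 * z) := by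
    simp [hp, shifted, Polynomial.eval_comp]
  rw [← h2, ← (hasSum_binomCoeff m hz).tsum_eq, ← hps.tsum_eq,
    tsum_mul_tsum_eq_tsum_sum_antidiagonal_of_summable_norm (summable_norm_binomCoeff m hz)
      hps.summable.norm]
  refine tsum_congr fun k => ?_
  rw [PowerSeries.coeff_mul, Finset.sum_mul]
  refine Finset.sum_congr rfl fun q hq => ?_
  rw [← Finset.HasAntidiagonal.mem_antidiagonal.1 hq, pow_add, hBdef, PowerSeries.coeff_mk,
    Polynomial.coeff_coe]
  ring

end Gegenbauer

/-! ### Weighted coefficients, integration by parts and rapid decay -/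

namespace Gegenbauer

/-- The weight `(1 - x ^ 2) ^ a`. -/
noncomputable def weight (a : ℂ) (x : ℝ) : ℂ := ((1 - x ^ 2 : ℝ) : ℂ) ^ a

/-- The value of `C_n^l` at a real point. -/
noncomputable def poly (l : ℂ) (n : ℕ) (x : ℝ) : ℂ := (gegenbauer l n).eval (x : ℂ)

theorem one_sub_sq_pos {x : ℝ} (hx : x ∈ Ioo (-1 : ℝ) 1) : 0 < 1 - x ^ 2 := by
  nlinarith [hx.1, hx.2]

theorem weight_add (a b : ℂ) {x : ℝ} (hx : x ∈ Ioo (-1 : ℝ) 1) :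
    weight (a + b) x = weight a x * weight b x :=
  Complex.cpow_add _ _ (by exact_mod_cast (one_sub_sq_pos hx).ne')

theorem weight_one (x : ℝ) : weight 1 x = 1 - (x : ℂ) ^ 2 := by
  simp [weight]

theorem contDiffAt_weight (a : ℂ) {x : ℝ} (hx : x ∈ Ioo (-1 : ℝ) 1) :
    ContDiffAt ℝ (⊤ : ℕ∞) (weight a) x := by
  have h : ContDiffAt ℂ (⊤ : ℕ∞) (fun z : ℂ => z ^ a) ((1 - x ^ 2 : ℝ) : ℂ) :=
    (AnalyticAt.cpow analyticAt_id analyticAt_const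
      (Complex.ofReal_mem_slitPlane.2 (one_sub_sq_pos hx))).contDiffAt
  have h2 : ContDiff ℝ (⊤ : ℕ∞) (fun x : ℝ => ((1 - x ^ 2 : ℝ) : ℂ)) :=
    Complex.ofRealCLM.contDiff.comp (contDiff_const.sub (contDiff_id.pow 2))
  exact ContDiffAt.comp x (h.restrict_scalars ℝ) h2.contDiffAt

theorem hasDerivAt_weight (a : ℂ) {x : ℝ} (hx : x ∈ Ioo (-1 : ℝ) 1) :
    HasDerivAt (weight a) (-(2 * a) * x * weight (a - 1) x) x := by
  have h1 : HasDerivAt (fun x : ℝ => ((1 - x ^ 2 : ℝ) : ℂ)) ((-(2 * x) : ℝ) : ℂ) x := by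
    apply HasDerivAt.ofReal_comp
    simpa using (hasDerivAt_pow 2 x).const_sub 1
  have h2 := HasDerivAt.comp_of_eq x (hasDerivAt_id' ((1 - x ^ 2 : ℝ) : ℂ) |>.cpow_const (c := a)
    (Complex.ofReal_mem_slitPlane.2 (one_sub_sq_pos hx))) h1 rfl
  refine h2.congr_deriv ?_
  rw [weight]
  push_cast
  ring

theorem continuousAt_weight {a : ℂ} {x : ℝ} (h : 0 < a.re ∨ 1 - x ^ 2 ≠ 0) :
    ContinuousAt (weight a) x :=
  ContinuousAt.comp_of_eq (f := fun x : ℝ => 1 - x ^ 2)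
    (Complex.continuousAt_ofReal_cpow_const (1 - x ^ 2) a h) (by fun_prop) rfl

theorem continuous_weight_mul {a : ℂ} {f : ℝ → ℂ} (hf : Continuous f)
    (h : 0 < a.re ∨ tsupport f ⊆ Ioo (-1 : ℝ) 1) : Continuous (fun x => weight a x * f x) := by
  rcases h with h | h
  · exact (continuous_iff_continuousAt.2 fun x => continuousAt_weight (Or.inl h)).mul hf
  · refine continuous_of_tsupport fun x hx => ?_
    have hx : x ∈ tsupport f := tsupport_mul_subset_right hx
    exact (continuousAt_weight (Or.inr (one_sub_sq_pos (h hx)).ne')).mul hf.continuousAt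

theorem hasDerivAt_poly (l : ℂ) (n : ℕ) (x : ℝ) :
    HasDerivAt (poly l n) ((gegenbauer l n).derivative.eval (x : ℂ)) x :=
  ((gegenbauer l n).hasDerivAt (x : ℂ)).comp_ofReal

theorem continuous_poly (l : ℂ) (n : ℕ) : Continuous (poly l n) :=
  continuous_iff_continuousAt.2 fun x => (hasDerivAt_poly l n x).continuousAt

/-- The Gegenbauer coefficients of `f` before normalization. -/
noncomputable def coef (l : ℂ) (f : ℝ → ℂ) (n : ℕ) : ℂ :=
  ∫ x in (-1 : ℝ)..1, poly l n x * (weight (l - 1 / 2) x * f x)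

/-- The weighted `L¹` norm of `f`. -/
noncomputable def mass (l : ℂ) (f : ℝ → ℂ) : ℝ :=
  ∫ x in (-1 : ℝ)..1, ‖weight (l - 1 / 2) x * f x‖

/-- Smooth functions for which integration by parts against the weight has no boundary terms. -/
def Admissible (l : ℂ) (f : ℝ → ℂ) : Prop :=
  ContDiff ℝ (⊤ : ℕ∞) f ∧ (1 / 2 < l.re ∨ tsupport f ⊆ Ioo (-1 : ℝ) 1)

/-- The Gegenbauer operator. -/
noncomputable def op (l : ℂ) (f : ℝ → ℂ) (x : ℝ) : ℂ :=
  (1 - (x : ℂ) ^ 2) * deriv (deriv f) x - (2 * l + 1) * x * deriv f x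

theorem contDiff_deriv {f : ℝ → ℂ} (hf : ContDiff ℝ (⊤ : ℕ∞) f) :
    ContDiff ℝ (⊤ : ℕ∞) (deriv f) :=
  ((contDiff_infty_iff_deriv).1 hf).2

variable {l : ℂ} {f : ℝ → ℂ}

theorem Admissible.deriv (hf : Admissible l f) : Admissible l (deriv f) :=
  ⟨contDiff_deriv hf.1, hf.2.imp_right (tsupport_deriv_subset.trans ·)⟩

theorem tsupport_op_subset (l : ℂ) (f : ℝ → ℂ) : tsupport (op l f) ⊆ tsupport f := by
  refine closure_minimal (fun x hx => ?_) (isClosed_tsupport f)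
  by_contra h
  have h1 : x ∉ tsupport (_root_.deriv f) := fun h' => h (tsupport_deriv_subset h')
  have h2 : x ∉ tsupport (_root_.deriv (_root_.deriv f)) := fun h' => h1 (tsupport_deriv_subset h')
  exact hx (by simp [op, image_eq_zero_of_notMem_tsupport h1, image_eq_zero_of_notMem_tsupport h2])

theorem Admissible.op (hf : Admissible l f) : Admissible l (op l f) := by
  refine ⟨?_, hf.2.imp_right ((tsupport_op_subset l f).trans ·)⟩
  have h1 := contDiff_deriv hf.1
  have h2 := contDiff_deriv h1
  have hx : ContDiff ℝ (⊤ : ℕ∞) (fun x : ℝ => (x : ℂ)) := Complex.ofRealCLM.contDiff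
  exact ((contDiff_const.sub (hx.pow 2)).mul h2).sub ((contDiff_const.mul hx).mul h1)

theorem Admissible.iterate_op (hf : Admissible l f) (m : ℕ) :
    Admissible l ((Gegenbauer.op l)^[m] f) := by
  induction m with
  | zero => exact hf
  | succ m ih => rw [Function.iterate_succ_apply']; exact ih.op

theorem Admissible.continuous_weight_mul (hf : Admissible l f) :
    Continuous (fun x => weight (l - 1 / 2) x * f x) := by
  refine Gegenbauer.continuous_weight_mul hf.1.continuous (hf.2.imp_left fun h => ?_)
  simp; linarith

theorem Admissible.continuous_weight_mul' (hf : Admissible l f) :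
    Continuous (fun x => weight (l + 1 / 2) x * f x) := by
  refine Gegenbauer.continuous_weight_mul hf.1.continuous (hf.2.imp_left fun h => ?_)
  simp; linarith

theorem Admissible.weight_mul_eq_zero (hf : Admissible l f) {x : ℝ} (hx : x ^ 2 = 1) :
    weight (l + 1 / 2) x * f x = 0 := by
  rcases hf.2 with h | h
  · have : l + 1 / 2 ≠ 0 := fun h0 => by
      have := congrArg Complex.re h0
      simp at this
      linarith
    rw [weight, hx, sub_self, Complex.ofReal_zero, Complex.zero_cpow this, zero_mul]
  · have h' : x ∉ tsupport f := fun h' => by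
      have := one_sub_sq_pos (h h')
      linarith
    rw [image_eq_zero_of_notMem_tsupport h', mul_zero]

/-- For g = f' the right-hand side is the weight times `op l f`: this is the divergence form of the
operator. -/
theorem hasDerivAt_weight_mul (l : ℂ) {x : ℝ} (hx : x ∈ Ioo (-1 : ℝ) 1) {g : ℝ → ℂ} {g' : ℂ}
    (hg : HasDerivAt g g' x) :
    HasDerivAt (fun x => weight (l + 1 / 2) x * g x)
      (weight (l - 1 / 2) x * ((1 - (x : ℂ) ^ 2) * g' - (2 * l + 1) * x * g x)) x := by
  refine ((hasDerivAt_weight (l + 1 / 2) hx).mul hg).congr_deriv ?_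
  have h : weight (l + 1 / 2) x = weight (l - 1 / 2) x * (1 - (x : ℂ) ^ 2) := by
    rw [← weight_one, ← weight_add _ _ hx]; congr 1; ring
  rw [h, show l + 1 / 2 - 1 = l - 1 / 2 by ring]
  ring

theorem Admissible.hasDerivAt (hf : Admissible l f) (x : ℝ) :
    HasDerivAt f (_root_.deriv f x) x :=
  (hf.1.differentiable (by simp) x).hasDerivAt

theorem ode_eval (l : ℂ) (n : ℕ) (x : ℝ) :
    (1 - (x : ℂ) ^ 2) * (gegenbauer l n).derivative.derivative.eval (x : ℂ) -
      (2 * l + 1) * x * (gegenbauer l n).derivative.eval (x : ℂ) =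
      -(n * (n + 2 * l)) * poly l n x := by
  have h := congrArg (Polynomial.eval (x : ℂ)) (ode l n)
  simp at h
  rw [poly]
  linear_combination h

theorem integral_eq_zero_of_hasDerivAt {F F' : ℝ → ℂ} (hF : Continuous F) (hF' : Continuous F')
    (hd : ∀ x ∈ Ioo (-1 : ℝ) 1, HasDerivAt F (F' x) x) (h1 : F 1 = 0) (h2 : F (-1) = 0) :
    ∫ x in (-1 : ℝ)..1, F' x = 0 := by
  rw [intervalIntegral.integral_eq_sub_of_hasDerivAt_of_le (by norm_num) hF.continuousOn hd
    (hF'.intervalIntegrable _ _), h1, h2, sub_zero]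

/-- Lagrange's identity: the integrand of the difference of the two sides is the derivative of w
(C_n f' - C_n' f) with w = (1-x²)^{l+1/2}, which vanishes at ±1 for admissible f. -/
theorem coef_op (hf : Admissible l f) (n : ℕ) :
    coef l (op l f) n = -(n * (n + 2 * l)) * coef l f n := by
  have c0 := hf.continuous_weight_mul
  have c2 := hf.op.continuous_weight_mul
  have b0 := hf.continuous_weight_mul'
  have b1 := hf.deriv.continuous_weight_mul'
  have cp := continuous_poly l n
  have cd : Continuous (fun x : ℝ => (gegenbauer l n).derivative.eval (x : ℂ)) := by fun_prop
  have key := integral_eq_zero_of_hasDerivAt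
    (F := fun x => poly l n x * (weight (l + 1 / 2) x * deriv f x) -
      (gegenbauer l n).derivative.eval (x : ℂ) * (weight (l + 1 / 2) x * f x))
    (F' := fun x => poly l n x * (weight (l - 1 / 2) x * op l f x) +
      (n * (n + 2 * l)) * (poly l n x * (weight (l - 1 / 2) x * f x)))
    (by fun_prop) (by fun_prop) (fun x hx => by
      have h := hasDerivAt_weight_mul l hx
        (((hasDerivAt_poly l n x).mul (hf.deriv.hasDerivAt x)).sub
        (((gegenbauer l n).derivative.hasDerivAt (x : ℂ)).comp_ofReal.mul (hf.hasDerivAt x)))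
      have e : (fun x => poly l n x * (weight (l + 1 / 2) x * deriv f x) -
          (gegenbauer l n).derivative.eval (x : ℂ) * (weight (l + 1 / 2) x * f x)) =
          fun x : ℝ => weight (l + 1 / 2) x * (poly l n x * deriv f x -
            (gegenbauer l n).derivative.eval (x : ℂ) * f x) := by
        ext x; ring
      rw [e]
      refine h.congr_deriv ?_
      have := ode_eval l n x
      simp only [op, Pi.mul_apply, Pi.sub_apply]
      linear_combination (-weight (l - 1 / 2) x * f x) * this)
    (by simp only [hf.weight_mul_eq_zero (one_pow 2), hf.deriv.weight_mul_eq_zero (one_pow 2)]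
        simp)
    (by simp only [hf.weight_mul_eq_zero (neg_one_sq),
          hf.deriv.weight_mul_eq_zero (neg_one_sq)]
        simp)
  rw [intervalIntegral.integral_add (Continuous.intervalIntegrable (by fun_prop) _ _)
    (Continuous.intervalIntegrable (by fun_prop) _ _), intervalIntegral.integral_const_mul] at key
  rw [coef, coef]
  linear_combination key

theorem coef_iterate_op (hf : Admissible l f) (n m : ℕ) :
    coef l ((op l)^[m] f) n = (-(n * (n + 2 * l))) ^ m * coef l f n := by
  induction m with
  | zero => simp
  | succ m ih =>
    rw [Function.iterate_succ_apply', coef_op (hf.iterate_op m), ih]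
    ring

/-- One integration by parts of the equation for C_{n+1} against f. The derivative of C_{n+1} is 2l
C_n for parameter l + 1, and (1-x²)^{l+1/2} is exactly the weight of that parameter. -/
theorem coef_succ (hf : ContDiff ℝ (⊤ : ℕ∞) f) (hs : tsupport f ⊆ Ioo (-1 : ℝ) 1) (n : ℕ) :
    ((n : ℂ) + 1) * (n + 1 + 2 * l) * coef l f (n + 1) = 2 * l * coef (l + 1) (deriv f) n := by
  have hf : Admissible l f := ⟨hf, Or.inr hs⟩
  have c0 := hf.continuous_weight_mul
  have b0 := hf.continuous_weight_mul'
  have b1 := hf.deriv.continuous_weight_mul'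
  have cp := continuous_poly l (n + 1)
  have cp' := continuous_poly (l + 1) n
  have hd : ∀ x : ℝ, (gegenbauer l (n + 1)).derivative.eval (x : ℂ) =
      2 * l * poly (l + 1) n x := fun x => by
    rw [derivative_eq]; simp [poly]
  have cd : Continuous (fun x : ℝ => (gegenbauer l (n + 1)).derivative.eval (x : ℂ)) := by fun_prop
  have key := integral_eq_zero_of_hasDerivAt
    (F := fun x => (gegenbauer l (n + 1)).derivative.eval (x : ℂ) * (weight (l + 1 / 2) x * f x))
    (F' := fun x => 2 * l * (poly (l + 1) n x * (weight (l + 1 / 2) x * deriv f x)) -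
      ((n : ℂ) + 1) * (n + 1 + 2 * l) * (poly l (n + 1) x * (weight (l - 1 / 2) x * f x)))
    (by fun_prop) (by fun_prop) (fun x hx => by
      have h := hasDerivAt_weight_mul l hx
        (((gegenbauer l (n + 1)).derivative.hasDerivAt (x : ℂ)).comp_ofReal.mul (hf.hasDerivAt x))
      have e : (fun x : ℝ => (gegenbauer l (n + 1)).derivative.eval (x : ℂ) *
          (weight (l + 1 / 2) x * f x)) =
          fun x : ℝ => weight (l + 1 / 2) x *
            ((gegenbauer l (n + 1)).derivative.eval (x : ℂ) * f x) := by
        ext x; ring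
      rw [e]
      refine h.congr_deriv ?_
      have := ode_eval l (n + 1) x
      have hw : weight (l + 1 / 2) x = weight (l - 1 / 2) x * (1 - (x : ℂ) ^ 2) := by
        rw [← weight_one, ← weight_add _ _ hx]; congr 1; ring
      have hdx := hd x
      push_cast at this
      simp only [Pi.mul_apply]
      rw [hw]
      linear_combination (weight (l - 1 / 2) x * f x) * this +
        weight (l - 1 / 2) x * (1 - (x : ℂ) ^ 2) * deriv f x * hdx)
    (by simp only [hf.weight_mul_eq_zero (one_pow 2)]
        simp)
    (by simp only [hf.weight_mul_eq_zero (neg_one_sq)]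
        simp)
  rw [intervalIntegral.integral_sub (Continuous.intervalIntegrable (by fun_prop) _ _)
    (Continuous.intervalIntegrable (by fun_prop) _ _), intervalIntegral.integral_const_mul,
    intervalIntegral.integral_const_mul] at key
  rw [coef, coef, show l + 1 - 1 / 2 = l + 1 / 2 by ring]
  linear_combination -key

theorem mass_nonneg (l : ℂ) (f : ℝ → ℂ) : 0 ≤ mass l f :=
  intervalIntegral.integral_nonneg (by norm_num) fun _ _ => norm_nonneg _

theorem norm_coef_le (hf : Admissible l f) {n : ℕ} {b : ℝ}
    (hb : ∀ x ∈ Icc (-1 : ℝ) 1, ‖poly l n x‖ ≤ b) : ‖coef l f n‖ ≤ b * mass l f := by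
  have c0 := hf.continuous_weight_mul
  rw [coef, mass, ← intervalIntegral.integral_const_mul]
  refine intervalIntegral.norm_integral_le_of_norm_le (by norm_num)
    (Filter.Eventually.of_forall fun x hx => ?_) (Continuous.intervalIntegrable (by fun_prop) _ _)
  rw [norm_mul]
  gcongr
  exact hb x ⟨hx.1.le, hx.2⟩

/-- Each application of `op` gains a factor n(n+2l). The exponent and constant do not depend on f,
which enters only through two masses; this uniformity serves the two-variable case. -/
theorem exists_decay (hl : Regular l) {a : ℕ → ℝ} (ha : PolyBounded a) :
    ∃ (m : ℕ) (D : ℝ), 0 ≤ D ∧ ∀ f, Admissible l f → ∀ n,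
      a n * ‖coef l f n‖ ≤ D * (mass l f + mass l ((op l)^[m] f)) * (1 / ((n : ℝ) + 1) ^ 2) := by
  obtain ⟨E, k, hE, ha⟩ := ha
  obtain ⟨B, ⟨C, M, hC, hBC⟩, hB0, hB⟩ := exists_bound l
  obtain ⟨c, hc, hcl⟩ := exists_natCast_add_one_le hl
  -- M powers absorb the growth of C_n, k that of a, and two more make the bound summable.
  set m := M + (k + 2) with hm
  refine ⟨m, E * (C * (1 + c ^ m)), by positivity, fun f hf n => ?_⟩
  have hn : (0 : ℝ) < (n : ℝ) + 1 := by positivity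
  have hm0 := mass_nonneg l f
  have hm1 := mass_nonneg l ((op l)^[m] f)
  have key : ((n : ℝ) + 1) ^ (k + 2) * ‖coef l f n‖ ≤
      C * (1 + c ^ m) * (mass l f + mass l ((op l)^[m] f)) := by
    -- For n = 0 the eigenvalue vanishes and gives no gain, so the mass of f itself is used.
    rcases n with _ | n
    · have h := norm_coef_le hf (hB 0)
      have h0 : B 0 ≤ C := by simpa using hBC 0
      simp only [Nat.cast_zero, zero_add, one_pow, one_mul]
      calc ‖coef l f 0‖ ≤ B 0 * mass l f := h
        _ ≤ C * mass l f := by gcongr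
        _ ≤ C * (1 + c ^ m) * (mass l f + mass l ((op l)^[m] f)) := by
            rw [mul_assoc]
            gcongr
            have : 0 ≤ c ^ m := by positivity
            nlinarith
    · set N : ℝ := ((n + 1 : ℕ) : ℝ) + 1 with hN
      have h1 := norm_coef_le (hf.iterate_op m) (hB (n + 1))
      rw [coef_iterate_op hf, norm_mul, norm_pow, norm_neg] at h1
      have h2 : N ≤ c * ‖((n + 1 : ℕ) : ℂ) * (((n + 1 : ℕ) : ℂ) + 2 * l)‖ := by
        rw [norm_mul, Complex.norm_natCast]
        have h3 := hcl (n + 1)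
        have h4 : (1 : ℝ) ≤ ((n + 1 : ℕ) : ℝ) := by simp
        calc N ≤ c * ‖((n + 1 : ℕ) : ℂ) + 2 * l‖ := h3
          _ ≤ ((n + 1 : ℕ) : ℝ) * (c * ‖((n + 1 : ℕ) : ℂ) + 2 * l‖) :=
              le_mul_of_one_le_left (by positivity) h4
          _ = _ := by ring
      have h5 : N ^ m * ‖coef l f (n + 1)‖ ≤ c ^ m * (C * N ^ M * mass l ((op l)^[m] f)) :=
        calc N ^ m * ‖coef l f (n + 1)‖
            ≤ (c * ‖((n + 1 : ℕ) : ℂ) * (((n + 1 : ℕ) : ℂ) + 2 * l)‖) ^ m *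
              ‖coef l f (n + 1)‖ := by gcongr
          _ = c ^ m * (‖((n + 1 : ℕ) : ℂ) * (((n + 1 : ℕ) : ℂ) + 2 * l)‖ ^ m *
              ‖coef l f (n + 1)‖) := by ring
          _ ≤ c ^ m * (B (n + 1) * mass l ((op l)^[m] f)) := by gcongr
          _ ≤ _ := by gcongr; exact hBC (n + 1)
      have h6 : N ^ M * (N ^ (k + 2) * ‖coef l f (n + 1)‖) ≤
          N ^ M * (c ^ m * C * mass l ((op l)^[m] f)) := by
        calc _ = N ^ m * ‖coef l f (n + 1)‖ := by rw [hm]; ring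
          _ ≤ _ := h5
          _ = _ := by ring
      refine (le_of_mul_le_mul_left h6 (by positivity)).trans ?_
      have h7 : 0 ≤ c ^ m := by positivity
      have h8 : 0 ≤ C * mass l f := by positivity
      have h9 : 0 ≤ C * mass l ((op l)^[m] f) := by positivity
      nlinarith [mul_nonneg h7 h8]
  rw [mul_one_div, le_div_iff₀ (by positivity)]
  calc a n * ‖coef l f n‖ * ((n : ℝ) + 1) ^ 2
      ≤ E * ((n : ℝ) + 1) ^ k * ‖coef l f n‖ * ((n : ℝ) + 1) ^ 2 := by gcongr; exact ha n
    _ = E * (((n : ℝ) + 1) ^ (k + 2) * ‖coef l f n‖) := by ring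
    _ ≤ E * (C * (1 + c ^ m) * (mass l f + mass l ((op l)^[m] f))) := by gcongr
    _ = _ := by ring

theorem summable_one_div_add_one_sq : Summable (fun n : ℕ => 1 / ((n : ℝ) + 1) ^ 2) := by
  have := (summable_nat_add_iff 1).2 (Real.summable_one_div_nat_pow.2 one_lt_two)
  simpa using this

theorem summable_mul_norm_coef (hl : Regular l) {a : ℕ → ℝ} (ha : PolyBounded a)
    (ha0 : ∀ n, 0 ≤ a n) (hf : Admissible l f) : Summable (fun n => a n * ‖coef l f n‖) := by
  obtain ⟨m, D, hD, h⟩ := exists_decay hl ha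
  exact Summable.of_nonneg_of_le (fun n => mul_nonneg (ha0 n) (norm_nonneg _)) (h f hf)
    (summable_one_div_add_one_sq.mul_left _)

end Gegenbauer

/-! ### Normalization constants and the closure term -/

namespace Gegenbauer

/-- The factor of the normalization of the Gegenbauer polynomials that does not depend on the
degree. -/
noncomputable def normConst (l : ℂ) : ℂ :=
  Complex.Gamma (2 * l) * ((2 : ℂ) ^ (1 / 2 - l) / Complex.Gamma (l + 1 / 2)) ^ 2

/-- The reciprocals of the normalization integrals of the Gegenbauer polynomials. -/
noncomputable def kappa (l : ℂ) (n : ℕ) : ℂ :=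
  ((n : ℂ) + l) * invEvalOne l n * normConst l

variable {l : ℂ}

theorem Gamma_mul_invEvalOne (hl : Regular l) (n : ℕ) :
    Complex.Gamma (2 * l + n) * invEvalOne l n = n.factorial * Complex.Gamma (2 * l) := by
  induction n with
  | zero => simp [invEvalOne]
  | succ n ih =>
    have h := invEvalOne_succ hl n
    have h1 : 2 * l + n ≠ 0 := by rw [add_comm]; exact hl n
    rw [Nat.cast_succ, ← add_assoc, Complex.Gamma_add_one _ h1, Nat.factorial_succ]
    push_cast
    linear_combination Complex.Gamma (2 * l + n) * h + ((n : ℂ) + 1) * ih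

theorem half_add_ne_zero (hl : Regular l) (n : ℕ) : (n : ℂ) + (l + 1 / 2) ≠ 0 := fun h => by
  have := hl (2 * n + 1)
  push_cast at this
  exact this (by linear_combination 2 * h)

theorem normConst_add_one (hl : Regular l) :
    normConst (l + 1) * (2 * l + 1) = normConst l * (2 * l) := by
  have h0 := hl 0
  have h1 := hl 1
  have h2 := half_add_ne_zero hl 0
  simp only [Nat.cast_zero, zero_add, Nat.cast_one] at h0 h1 h2
  have h1' : 2 * l + 1 ≠ 0 := by rw [add_comm]; exact h1
  have hG : Complex.Gamma (l + 1 / 2) ≠ 0 := Complex.Gamma_ne_zero fun m h =>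
    half_add_ne_zero hl m (by rw [h]; ring)
  rw [normConst, normConst, show 2 * (l + 1) = 2 * l + 1 + 1 by ring, Complex.Gamma_add_one _ h1',
    Complex.Gamma_add_one _ h0, show l + 1 + 1 / 2 = l + 1 / 2 + 1 by ring,
    Complex.Gamma_add_one _ h2, show 1 / 2 - (l + 1) = 1 / 2 - l - 1 by ring,
    Complex.cpow_sub _ _ two_ne_zero, Complex.cpow_one]
  have h3 : (l + 1 / 2) = (2 * l + 1) / 2 := by ring
  rw [h3] at hG ⊢
  field_simp

theorem invEvalOne_add_one (hl : Regular l) (n : ℕ) :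
    invEvalOne (l + 1) n * (((n : ℂ) + 1) * (n + 1 + 2 * l)) =
      invEvalOne l (n + 1) * (2 * l * (2 * l + 1)) := by
  induction n with
  | zero =>
    have h0 := hl 0
    have h := invEvalOne_succ hl 0
    simp [invEvalOne] at h h0 ⊢
    field_simp
    ring
  | succ n ih =>
    have h1 := invEvalOne_succ hl (n + 1)
    have h2 := invEvalOne_succ hl.add_one n
    have h3 := hl (n + 2)
    have h4 := hl (n + 1)
    push_cast at *
    apply mul_left_cancel₀ h4
    linear_combination ((n : ℂ) + 2) * (n + 1 + 2 * l) * h2 + ((n : ℂ) + 2) * ih -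
      (2 * l * (2 * l + 1)) * h1

/-- Together with `coef_succ` this matches the differentiated series for l with the series of the
derivative for l + 1. -/
theorem kappa_add_one (hl : Regular l) (n : ℕ) :
    kappa (l + 1) n * (((n : ℂ) + 1) * (n + 1 + 2 * l)) = kappa l (n + 1) * (2 * l) ^ 2 := by
  have h1 := hl 1
  have h1' : 2 * l + 1 ≠ 0 := by rw [add_comm]; simpa using h1
  have h2 := invEvalOne_add_one hl n
  have h3 := normConst_add_one hl
  apply mul_left_cancel₀ h1'
  rw [kappa, kappa]
  push_cast
  linear_combination ((n : ℂ) + (l + 1)) * (2 * l + 1) * normConst (l + 1) * h2 +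
    ((n : ℂ) + (l + 1)) * invEvalOne l (n + 1) * (2 * l * (2 * l + 1)) * h3

theorem polyBounded_invEvalOne (hl : Regular l) : PolyBounded (fun n => ‖invEvalOne l n‖) :=
  PolyBounded.of_ratio hl (invEvalOne_succ hl)

theorem polyBounded_kappa (hl : Regular l) : PolyBounded (fun n => ‖kappa l n‖) := by
  have h : PolyBounded (fun n => ‖(n : ℂ) + l‖) :=
    (PolyBounded.natCast_add_one.mul (PolyBounded.const (c := 1 + ‖l‖) (by positivity))
      fun n => by positivity).mono fun n => by
        have h1 := norm_add_le (n : ℂ) l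
        rw [Complex.norm_natCast] at h1
        have h2 : (0 : ℝ) ≤ n := n.cast_nonneg
        nlinarith [norm_nonneg l, mul_nonneg h2 (norm_nonneg l)]
  refine ((h.mul (polyBounded_invEvalOne hl) fun n => norm_nonneg _).mul
    (PolyBounded.const (norm_nonneg (normConst l))) fun n => norm_nonneg _).mono fun n => ?_
  rw [kappa, norm_mul, norm_mul]

/-- The Christoffel–Darboux kernel. -/
theorem sum_kappa (hl : Regular l) (N : ℕ) (x y : ℝ) :
    ((x : ℂ) - y) * ∑ n ∈ Finset.range (N + 1), kappa l n * poly l n y * poly l n x =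
      (invEvalOne l N * ((N : ℂ) + 1) * normConst l / 2) *
        (poly l (N + 1) x * poly l N y - poly l N x * poly l (N + 1) y) := by
  have h := christoffel_darboux hl N x y
  have e : ∑ n ∈ Finset.range (N + 1), kappa l n * poly l n y * poly l n x =
      normConst l * ∑ n ∈ Finset.range (N + 1), ((n : ℂ) + l) * invEvalOne l n *
        (gegenbauer l n).eval (x : ℂ) * (gegenbauer l n).eval (y : ℂ) := by
    rw [Finset.mul_sum]
    refine Finset.sum_congr rfl fun n _ => ?_
    rw [kappa, poly, poly]
    ring
  rw [e]
  simp only [poly]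
  linear_combination normConst l / 2 * h

theorem ferrersPNeg_eq {m : ℂ} (hl : Regular (m + 1 / 2)) (n : ℕ) {x : ℝ}
    (hx : x ∈ Ioo (-1 : ℝ) 1) :
    ferrersPNeg (n + m) m x = (2 : ℂ) ^ (-m) / Complex.Gamma (m + 1) *
      invEvalOne (m + 1 / 2) n * weight (m / 2) x * poly (m + 1 / 2) n x := by
  have hm : ∀ k : ℕ, (k : ℂ) + (m + 1) ≠ 0 := fun k h =>
    half_add_ne_zero hl k (by linear_combination h)
  have hp : 0 < 1 - x := by linarith [hx.2]
  have hq : 0 < 1 + x := by linarith [hx.1]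
  have hz : ‖(((1 - x) / 2 : ℝ) : ℂ)‖ < 1 := by
    rw [Complex.norm_real, Real.norm_of_nonneg (by positivity)]
    linarith
  rw [ferrersPNeg, hypergeometric_eq hm hl n hz, poly]
  have h1 : (1 - 2 * (((1 - x) / 2 : ℝ) : ℂ)) = x := by push_cast; ring
  have h2 : (1 - (((1 - x) / 2 : ℝ) : ℂ)) = ((1 + x) / 2 : ℝ) := by push_cast; ring
  have hcpow {r : ℝ} (hr : 0 < r) (s : ℂ) : (r : ℂ) ^ s = Complex.exp (Real.log r * s) := by
    rw [Complex.cpow_def_of_ne_zero (by exact_mod_cast hr.ne'), Complex.ofReal_log hr.le]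
  -- All bases are positive reals, so the powers combine through real logarithms.
  have key : (((1 - x) / (1 + x) : ℝ) : ℂ) ^ (m / 2) * (((1 + x) / 2 : ℝ) : ℂ) ^ m =
      (2 : ℂ) ^ (-m) * weight (m / 2) x := by
    have h3 : (2 : ℂ) ^ (-m) = ((2 : ℝ) : ℂ) ^ (-m) := by norm_num
    rw [weight, h3, hcpow (by positivity), hcpow (by positivity), hcpow two_pos,
      hcpow (one_sub_sq_pos hx), ← Complex.exp_add, ← Complex.exp_add,
      show 1 - x ^ 2 = (1 - x) * (1 + x) by ring, Real.log_div hp.ne' hq.ne',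
      Real.log_div hq.ne' two_ne_zero, Real.log_mul hp.ne' hq.ne']
    congr 1
    push_cast
    ring
  rw [h1, h2]
  linear_combination (1 / Complex.Gamma (m + 1) * (invEvalOne (m + 1 / 2) n *
    (gegenbauer (m + 1 / 2) n).eval (x : ℂ))) * key

/-- Γ(2l+n)/n! cancels one of the two factors n!/(2l)_n coming from the Ferrers functions, up to
Γ(2l). -/
theorem closureTerm_eq {m : ℂ} (hl : Regular (m + 1 / 2)) (n : ℕ) {x y : ℝ}
    (hx : x ∈ Ioo (-1 : ℝ) 1) (hy : y ∈ Ioo (-1 : ℝ) 1) :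
    closureTerm m n x y = kappa (m + 1 / 2) n * poly (m + 1 / 2) n y *
      (poly (m + 1 / 2) n x * (weight (m / 2) x * weight (m / 2) y)) := by
  rw [closureTerm, ferrersPNeg_eq hl n hx, ferrersPNeg_eq hl n hy, kappa, normConst]
  have h := Gamma_mul_invEvalOne hl n
  rw [show 2 * (m + 1 / 2) + n = 2 * m + n + 1 by ring] at h
  have hf : (n.factorial : ℂ) ≠ 0 := Nat.cast_ne_zero.2 n.factorial_ne_zero
  rw [show 1 / 2 - (m + 1 / 2) = -m by ring, show m + 1 / 2 + 1 / 2 = m + 1 by ring]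
  have h' : Complex.Gamma (2 * m + n + 1) / n.factorial * invEvalOne (m + 1 / 2) n =
      Complex.Gamma (2 * (m + 1 / 2)) := by
    rw [div_mul_eq_mul_div, h, mul_div_cancel_left₀ _ hf]
  linear_combination ((m + n + 1 / 2) * ((2 : ℂ) ^ (-m) / Complex.Gamma (m + 1)) ^ 2 *
    invEvalOne (m + 1 / 2) n * poly (m + 1 / 2) n x * poly (m + 1 / 2) n y *
    weight (m / 2) x * weight (m / 2) y) * h'

/-- The normalization integral of degree zero. -/
theorem kappa_zero_mul_integral (hl : 1 / 2 < l.re) :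
    kappa l 0 * ∫ x in (-1 : ℝ)..1, weight (l - 1 / 2) x = 1 := by
  have h0 : 0 < (l + 1 / 2).re := by simp; linarith
  have hG : Complex.Gamma (l + 1 / 2) ≠ 0 := Complex.Gamma_ne_zero_of_re_pos h0
  have hB := Complex.Gamma_mul_Gamma_eq_betaIntegral h0 h0
  have hl0 : 2 * l ≠ 0 := fun h => by
    have := congrArg Complex.re h
    simp at this
    linarith
  have hG2 : Complex.Gamma (2 * l) ≠ 0 := Complex.Gamma_ne_zero_of_re_pos (by simp; linarith)
  -- The substitution x = 2t - 1 gives 1 - x² = 4t(1-t), hence a Beta integral.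
  have hI : ∫ x in (-1 : ℝ)..1, weight (l - 1 / 2) x =
      (2 : ℂ) * 2 ^ (2 * l - 1) * Complex.betaIntegral (l + 1 / 2) (l + 1 / 2) := by
    have h1 := intervalIntegral.integral_comp_mul_add (a := 0) (b := 1) (c := (2 : ℝ))
      (weight (l - 1 / 2)) two_ne_zero (-1)
    rw [show (2 : ℝ) * 0 + -1 = -1 by norm_num, show (2 : ℝ) * 1 + -1 = 1 by norm_num,
      Complex.real_smul] at h1
    have h2 : ∫ x in (-1 : ℝ)..1, weight (l - 1 / 2) x =
        2 * ∫ x in (0 : ℝ)..1, weight (l - 1 / 2) (2 * x + -1) := by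
      rw [h1]; push_cast; ring
    rw [h2, mul_assoc, Complex.betaIntegral,
      ← intervalIntegral.integral_const_mul (2 ^ (2 * l - 1) : ℂ)]
    congr 1
    refine intervalIntegral.integral_congr fun x hx => ?_
    rw [uIcc_of_le zero_le_one] at hx
    have h3 : (1 - (2 * x + -1) ^ 2 : ℝ) = (2 * 2) * (x * (1 - x)) := by ring
    have h4 : ((2 : ℂ) * 2) ^ (l - 1 / 2) = 2 ^ (2 * l - 1) := by
      have := Complex.mul_cpow_ofReal_nonneg zero_le_two zero_le_two (l - 1 / 2)
      push_cast at this
      rw [this, ← Complex.cpow_add _ _ two_ne_zero]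
      congr 1
      ring
    have h5 := Complex.mul_cpow_ofReal_nonneg (by norm_num : (0 : ℝ) ≤ 2 * 2)
      (mul_nonneg hx.1 (sub_nonneg.2 hx.2)) (l - 1 / 2)
    have h6 := Complex.mul_cpow_ofReal_nonneg hx.1 (sub_nonneg.2 hx.2) (l - 1 / 2)
    push_cast at h5 h6
    simp only [weight]
    rw [h3]
    push_cast
    rw [h5, h6, h4, show l + 1 / 2 - 1 = l - 1 / 2 by ring]
  rw [show l + 1 / 2 + (l + 1 / 2) = 2 * l + 1 by ring, Complex.Gamma_add_one _ hl0] at hB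
  have h7 : ((2 : ℂ) ^ (1 / 2 - l)) ^ 2 * 2 ^ (2 * l - 1) = 1 := by
    rw [pow_two, ← Complex.cpow_add _ _ two_ne_zero, ← Complex.cpow_add _ _ two_ne_zero,
      show 1 / 2 - l + (1 / 2 - l) + (2 * l - 1) = 0 by ring, Complex.cpow_zero]
  rw [hI, kappa, normConst, invEvalOne]
  simp only [Nat.cast_zero, zero_add, mul_one, div_pow]
  generalize (2 : ℂ) ^ (1 / 2 - l) = T at *
  generalize (2 : ℂ) ^ (2 * l - 1) = U at *
  generalize Complex.betaIntegral (l + 1 / 2) (l + 1 / 2) = b at *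
  generalize Complex.Gamma (l + 1 / 2) = G at *
  generalize Complex.Gamma (2 * l) = H at *
  field_simp
  linear_combination 2 * l * H * b * h7 - hB

end Gegenbauer

/-! ### Smooth division: Hadamard's lemma -/

theorem contDiff_of_contDiffAt_tsupport {E : Type*} [NormedAddCommGroup E] [NormedSpace ℝ E]
    {f : E → ℂ} (h : ∀ x ∈ tsupport f, ContDiffAt ℝ (⊤ : ℕ∞) f x) : ContDiff ℝ (⊤ : ℕ∞) f := by
  refine contDiff_iff_contDiffAt.2 fun x => ?_
  by_cases hx : x ∈ tsupport f
  · exact h x hx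
  · exact contDiffAt_const.congr_of_eventuallyEq (notMem_tsupport_iff_eventuallyEq.1 hx)

/-- The integrals in Hadamard's lemma. -/
noncomputable def hadamardIntegral (y : ℝ) (k : ℕ) (f : ℝ → ℂ) (x : ℝ) : ℂ :=
  ∫ t in (0 : ℝ)..1, (t : ℂ) ^ k * f (y + t * (x - y))

theorem hasDerivAt_hadamardIntegral (y : ℝ) (k : ℕ) {f : ℝ → ℂ} (hf : ContDiff ℝ (⊤ : ℕ∞) f)
    (hc : HasCompactSupport f) (x : ℝ) :
    HasDerivAt (hadamardIntegral y k f) (hadamardIntegral y (k + 1) (deriv f) x) x := by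
  have hf' : Continuous (deriv f) := (Gegenbauer.contDiff_deriv hf).continuous
  have hf0 := hf.continuous
  obtain ⟨C, hC⟩ := hf'.bounded_above_of_compact_support hc.deriv
  refine (intervalIntegral.hasDerivAt_integral_of_dominated_loc_of_deriv_le
    (F := fun x t => (t : ℂ) ^ k * f (y + t * (x - y)))
    (F' := fun x t => (t : ℂ) ^ (k + 1) * deriv f (y + t * (x - y)))
    (bound := fun _ => C) Filter.univ_mem
    (Filter.Eventually.of_forall fun z => Continuous.aestronglyMeasurable (by fun_prop))
    (Continuous.intervalIntegrable (by fun_prop) _ _)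
    (Continuous.aestronglyMeasurable (by fun_prop))
    (Filter.Eventually.of_forall fun t ht z _ => ?_)
    intervalIntegrable_const
    (Filter.Eventually.of_forall fun t _ z _ => ?_)).2
  · rw [uIoc_of_le zero_le_one] at ht
    rw [norm_mul, norm_pow, Complex.norm_real, Real.norm_of_nonneg ht.1.le]
    calc t ^ (k + 1) * ‖deriv f (y + t * (z - y))‖ ≤ 1 * C :=
          mul_le_mul (pow_le_one₀ ht.1.le ht.2) (hC _) (norm_nonneg _) zero_le_one
      _ = C := one_mul C
  · have h1 : HasDerivAt (fun z : ℝ => y + t * (z - y)) t z := by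
      simpa using (((hasDerivAt_id z).sub_const y).const_mul t).const_add y
    have h2 := (hf.differentiable (by simp) (y + t * (z - y))).hasDerivAt.scomp z h1
    refine (h2.const_mul ((t : ℂ) ^ k)).congr_deriv ?_
    rw [Complex.real_smul]
    ring

/-- Differentiation raises k by one and replaces f by f', so the induction on the order of
smoothness runs over all k and f at once. -/
theorem contDiff_hadamardIntegral (y : ℝ) (n : ℕ) : ∀ (k : ℕ) {f : ℝ → ℂ},
    ContDiff ℝ (⊤ : ℕ∞) f → HasCompactSupport f → ContDiff ℝ n (hadamardIntegral y k f) := by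
  induction n with
  | zero =>
    intro k f hf hc
    refine contDiff_zero.2 (continuous_iff_continuousAt.2 fun x =>
      (hasDerivAt_hadamardIntegral y k hf hc x).continuousAt)
  | succ n ih =>
    intro k f hf hc
    have h : deriv (hadamardIntegral y k f) = hadamardIntegral y (k + 1) (deriv f) :=
      funext fun x => (hasDerivAt_hadamardIntegral y k hf hc x).deriv
    push_cast
    rw [contDiff_succ_iff_deriv, h]
    exact ⟨fun x => (hasDerivAt_hadamardIntegral y k hf hc x).differentiableAt, by simp,
      ih (k + 1) (Gegenbauer.contDiff_deriv hf) hc.deriv⟩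

/-- Hadamard's lemma. -/
theorem exists_sub_eq_mul {f : ℝ → ℂ} (hf : ContDiff ℝ (⊤ : ℕ∞) f) (hc : HasCompactSupport f)
    (y : ℝ) : ∃ g : ℝ → ℂ, ContDiff ℝ (⊤ : ℕ∞) g ∧ ∀ x, f x - f y = ((x : ℂ) - y) * g x := by
  have hf1 := Gegenbauer.contDiff_deriv hf
  refine ⟨hadamardIntegral y 0 (deriv f), contDiff_infty.2 fun n =>
    contDiff_hadamardIntegral y n 0 hf1 hc.deriv, fun x => ?_⟩
  have hf' := hf1.continuous
  rw [hadamardIntegral, ← intervalIntegral.integral_const_mul,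
    intervalIntegral.integral_eq_sub_of_hasDerivAt (f := fun t : ℝ => f (y + t * (x - y)))]
  · simp
  · intro t _
    have h1 : HasDerivAt (fun t : ℝ => y + t * (x - y)) (x - y) t := by
      simpa using ((hasDerivAt_id t).mul_const (x - y)).const_add y
    refine ((hf.differentiable (by simp) (y + t * (x - y))).hasDerivAt.scomp t h1).congr_deriv ?_
    rw [Complex.real_smul]
    push_cast
    ring
  · exact Continuous.intervalIntegrable (by fun_prop) _ _

/-! ### The pointwise expansion theorem -/

namespace Gegenbauer

variable {l : ℂ} {f : ℝ → ℂ}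

open Filter Topology

theorem polyBounded_kappa_mul (hl : Regular l) {B : ℕ → ℝ} (hB : PolyBounded B)
    (hB0 : ∀ n, 0 ≤ B n) : PolyBounded (fun n => ‖kappa l n‖ * B n) :=
  (polyBounded_kappa hl).mul hB hB0

theorem summable_expansion (hl : Regular l) (hf : Admissible l f) {y : ℝ}
    (hy : y ∈ Icc (-1 : ℝ) 1) : Summable (fun n => kappa l n * poly l n y * coef l f n) := by
  obtain ⟨B, hBp, hB0, hB⟩ := exists_bound l
  refine Summable.of_norm_bounded (summable_mul_norm_coef hl (polyBounded_kappa_mul hl hBp hB0)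
    (fun n => mul_nonneg (norm_nonneg _) (hB0 n)) hf) fun n => ?_
  rw [norm_mul, norm_mul]
  gcongr
  exact hB n y hy

theorem tendsto_mul_coef (hl : Regular l) (hf : Admissible l f) {d : ℕ → ℂ}
    (hd : PolyBounded fun n => ‖d n‖) (j : ℕ) :
    Tendsto (fun n => d n * coef l f (n + j)) atTop (𝓝 0) := by
  obtain ⟨C, k, hC, hd⟩ := hd
  have h := (summable_mul_norm_coef hl (a := fun n => C * ((n : ℝ) + 1) ^ k)
    ⟨C, k, hC, fun n => le_rfl⟩ (fun n => by positivity) hf).tendsto_atTop_zero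
  refine squeeze_zero_norm (fun n => ?_) ((tendsto_add_atTop_iff_nat j).2 h)
  rw [norm_mul]
  gcongr
  refine (hd n).trans ?_
  gcongr
  linarith [(j.cast_nonneg : (0 : ℝ) ≤ j)]

theorem contDiff_ofReal_sub (y : ℝ) : ContDiff ℝ (⊤ : ℕ∞) (fun x : ℝ => (x : ℂ) - y) :=
  Complex.ofRealCLM.contDiff.sub contDiff_const

theorem Admissible.sub_mul (hf : Admissible l f) (y : ℝ) :
    Admissible l (fun x => ((x : ℂ) - y) * f x) :=
  ⟨(contDiff_ofReal_sub y).mul hf.1, hf.2.imp_right (tsupport_mul_subset_right.trans ·)⟩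

/-- The factor x - y turns the Christoffel–Darboux kernel into two products, so the partial sum is
d_N (C_N(y) c_{N+1} - C_{N+1}(y) c_N) with c the coefficients of f. Rapid decay of c beats the
polynomial growth of the rest. -/
theorem hasSum_sub_mul (hl : Regular l) (hf : Admissible l f) {y : ℝ}
    (hy : y ∈ Icc (-1 : ℝ) 1) :
    HasSum (fun n => kappa l n * poly l n y * coef l (fun x => ((x : ℂ) - y) * f x) n) 0 := by
  have hs := (summable_expansion hl (hf.sub_mul y) hy).hasSum
  set d : ℕ → ℂ := fun N => invEvalOne l N * ((N : ℂ) + 1) * normConst l / 2 with hd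
  have hdp : PolyBounded (fun n => ‖d n‖) := by
    refine (((polyBounded_invEvalOne hl).mul PolyBounded.natCast_add_one
      fun n => by positivity).mul (PolyBounded.const (norm_nonneg (normConst l / 2)))
      fun n => norm_nonneg _).mono fun n => ?_
    have h : ‖(n : ℂ) + 1‖ = (n : ℝ) + 1 := by
      rw [← Nat.cast_succ, Complex.norm_natCast, Nat.cast_succ]
    rw [hd]
    simp only
    rw [mul_div_assoc, norm_mul, norm_mul, h]
  have hpart : ∀ N : ℕ, ∑ n ∈ Finset.range (N + 1),
      kappa l n * poly l n y * coef l (fun x => ((x : ℂ) - y) * f x) n =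
      d N * poly l N y * coef l f (N + 1) - d N * poly l (N + 1) y * coef l f N := by
    intro N
    have c0 := hf.continuous_weight_mul
    have c1 := (hf.sub_mul y).continuous_weight_mul
    have cp := continuous_poly l
    have i0 : ∀ n, IntervalIntegrable
        (fun x => poly l n x * (weight (l - 1 / 2) x * f x)) volume (-1) 1 :=
      fun n => Continuous.intervalIntegrable (by fun_prop) _ _
    simp only [coef]
    simp only [← intervalIntegral.integral_const_mul]
    rw [← intervalIntegral.integral_finsetSum fun n _ =>
      Continuous.intervalIntegrable (by fun_prop) _ _,
      ← intervalIntegral.integral_sub ((i0 _).const_mul _) ((i0 _).const_mul _)]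
    refine intervalIntegral.integral_congr fun x _ => ?_
    have h := sum_kappa hl N x y
    have e : ∑ n ∈ Finset.range (N + 1), kappa l n * poly l n y *
        (poly l n x * (weight (l - 1 / 2) x * (((x : ℂ) - y) * f x))) =
        (weight (l - 1 / 2) x * f x) * (((x : ℂ) - y) *
          ∑ n ∈ Finset.range (N + 1), kappa l n * poly l n y * poly l n x) := by
      rw [Finset.mul_sum, Finset.mul_sum]
      exact Finset.sum_congr rfl fun n _ => by ring
    rw [e, h, hd]
    ring
  obtain ⟨B, hBp, hB0, hB⟩ := exists_bound l
  have hp : ∀ j, PolyBounded (fun n => ‖poly l (n + j) y‖) := fun j => by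
    have : PolyBounded (fun n => B (n + j)) := by
      induction j with
      | zero => exact hBp
      | succ j ih => simpa only [add_right_comm, add_assoc] using PolyBounded.succ ih
    exact this.mono fun n => hB _ y hy
  have hdj : ∀ j, PolyBounded (fun n => ‖d n * poly l (n + j) y‖) := fun j =>
    (hdp.mul (hp j) fun n => norm_nonneg _).mono fun n => (norm_mul _ _).le
  have hlim := (tendsto_mul_coef hl hf (hdj 0) 1).sub (tendsto_mul_coef hl hf (hdj 1) 0)
  rw [sub_zero] at hlim
  have hlim2 := (tendsto_add_atTop_iff_nat 1).2 hs.tendsto_sum_nat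
  simp only [hpart] at hlim2
  rw [tendsto_nhds_unique hlim2 hlim] at hs
  exact hs

/-- Smooth functions with compact support in `(-1, 1)` are the sums of their Gegenbauer
expansions. -/
def HasExpansion (l : ℂ) : Prop :=
  ∀ f : ℝ → ℂ, ContDiff ℝ (⊤ : ℕ∞) f → tsupport f ⊆ Ioo (-1 : ℝ) 1 → ∀ y ∈ Ioo (-1 : ℝ) 1,
    HasSum (fun n => kappa l n * poly l n y * coef l f n) (f y)

theorem hasCompactSupport_of_subset (hs : tsupport f ⊆ Ioo (-1 : ℝ) 1) : HasCompactSupport f :=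
  isCompact_Icc.of_isClosed_subset (isClosed_tsupport f) (hs.trans Ioo_subset_Icc_self)

theorem coef_one_eq_zero (hl : Regular l) (hre : 1 / 2 < l.re) {n : ℕ} (hn : n ≠ 0) :
    coef l (fun _ => 1) n = 0 := by
  have h := coef_op (f := fun _ => 1) ⟨contDiff_const, Or.inl hre⟩ n
  have h0 : op l (fun _ => 1) = fun _ => 0 := by
    ext x; simp [op]
  rw [h0] at h
  have h1 : coef l (fun _ => 0) n = 0 := by simp [coef]
  rw [h1, eq_comm, mul_eq_zero, neg_eq_zero, mul_eq_zero] at h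
  rcases h with (h | h) | h
  · exact absurd (Nat.cast_eq_zero.1 h) hn
  · exact absurd h (hl n)
  · exact h

/-- The quotient g = (f - f(y))/(x - y) is smooth but need not have compact support in (-1,1). For
Re l > 1/2 both g and constants are still admissible. -/
theorem hasExpansion_of_re (hl : Regular l) (hre : 1 / 2 < l.re) : HasExpansion l := by
  intro f hf hs y hy
  obtain ⟨g, hg, hfg⟩ := exists_sub_eq_mul hf (hasCompactSupport_of_subset hs) y
  have hga : Admissible l g := ⟨hg, Or.inl hre⟩
  have h1a : Admissible l (fun _ => 1) := ⟨contDiff_const, Or.inl hre⟩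
  have h0 := hasSum_sub_mul hl hga (Ioo_subset_Icc_self hy)
  have hsplit : ∀ n, coef l f n =
      coef l (fun x => ((x : ℂ) - y) * g x) n + f y * coef l (fun _ => 1) n := fun n => by
    have c1 := (hga.sub_mul y).continuous_weight_mul
    have c2 := h1a.continuous_weight_mul
    have cp := continuous_poly l n
    simp only [coef]
    rw [← intervalIntegral.integral_const_mul, ← intervalIntegral.integral_add
      (Continuous.intervalIntegrable (by fun_prop) _ _)
      (Continuous.intervalIntegrable (by fun_prop) _ _)]
    refine intervalIntegral.integral_congr fun x _ => ?_
    linear_combination (poly l n x * weight (l - 1 / 2) x) * hfg x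
  have h1 : HasSum (fun n => kappa l n * poly l n y * (f y * coef l (fun _ => 1) n)) (f y) := by
    have h2 := hasSum_single (f := fun n => kappa l n * poly l n y * (f y * coef l (fun _ => 1) n))
      0 fun n hn => by rw [coef_one_eq_zero hl hre hn]; ring
    have hp : poly l 0 = fun _ => 1 := by ext x; simp [poly, gegenbauer]
    have h3 := kappa_zero_mul_integral hre
    have h4 : coef l (fun _ => 1) 0 = ∫ x in (-1 : ℝ)..1, weight (l - 1 / 2) x := by
      simp [coef, hp]
    convert! h2 using 1
    rw [h4, hp]
    linear_combination -f y * h3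
  have := h0.add h1
  rw [zero_add] at this
  refine this.congr_fun fun n => ?_
  rw [hsplit]
  ring

/-- Localization: off the support, f/(x - y) is smooth with support in that of f, so
`hasSum_sub_mul` applies for every regular l. -/
theorem hasSum_zero_of_notMem (hl : Regular l) (hf : ContDiff ℝ (⊤ : ℕ∞) f)
    (hs : tsupport f ⊆ Ioo (-1 : ℝ) 1) {y : ℝ} (hy : y ∈ Icc (-1 : ℝ) 1) (hyf : y ∉ tsupport f) :
    HasSum (fun n => kappa l n * poly l n y * coef l f n) 0 := by
  set g : ℝ → ℂ := fun x => ((x : ℂ) - y)⁻¹ * f x with hg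
  have hgs : tsupport g ⊆ tsupport f := tsupport_mul_subset_right
  have hga : Admissible l g := by
    refine ⟨contDiff_of_contDiffAt_tsupport fun x hx => ?_, Or.inr (hgs.trans hs)⟩
    have hxy : (x : ℂ) - y ≠ 0 := by
      rw [sub_ne_zero]
      exact_mod_cast fun h : x = y => hyf (h ▸ hgs hx)
    exact ((contDiff_ofReal_sub y).contDiffAt.inv hxy).mul hf.contDiffAt
  have h := hasSum_sub_mul hl hga hy
  have e : (fun x : ℝ => ((x : ℂ) - y) * g x) = f := by
    ext x
    rcases eq_or_ne x y with rfl | hxy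
    · rw [image_eq_zero_of_notMem_tsupport hyf]; simp
    · have : (x : ℂ) - y ≠ 0 := by
        rw [sub_ne_zero]
        exact_mod_cast hxy
      rw [hg]
      simp only
      rw [mul_inv_cancel_left₀ this]
  rwa [e] at h

theorem HasExpansion.of_add_one (hl : Regular l) (h : HasExpansion (l + 1)) : HasExpansion l := by
  intro f hf hs y hy
  have hfa : Admissible l f := ⟨hf, Or.inr hs⟩
  have hf' : Admissible (l + 1) (deriv f) :=
    ⟨contDiff_deriv hf, Or.inr (tsupport_deriv_subset.trans hs)⟩
  obtain ⟨B, hBp, hB0, hB⟩ := exists_bound (l + 1)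
  have hsum : ∀ y ∈ Ioo (-1 : ℝ) 1,
      Summable (fun n => kappa l n * poly l n y * coef l f n) := fun y hy =>
    summable_expansion hl hfa (Ioo_subset_Icc_self hy)
  have hterm : ∀ n y, HasDerivAt (fun y => kappa l (n + 1) * poly l (n + 1) y * coef l f (n + 1))
      (kappa (l + 1) n * poly (l + 1) n y * coef (l + 1) (deriv f) n) y := fun n y => by
    refine (((hasDerivAt_poly l (n + 1) y).const_mul _).mul_const _).congr_deriv ?_
    have h1 := coef_succ hf hs (l := l) n
    have h2 := kappa_add_one hl n
    have h3 : (gegenbauer l (n + 1)).derivative.eval (y : ℂ) = 2 * l * poly (l + 1) n y := by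
      rw [derivative_eq]; simp [poly]
    have h4 := mul_ne_zero (Nat.cast_add_one_ne_zero n : (n : ℂ) + 1 ≠ 0) (hl (n + 1))
    push_cast at h4
    rw [h3]
    apply mul_left_cancel₀ h4
    linear_combination kappa l (n + 1) * (2 * l) * poly (l + 1) n y * h1 -
      poly (l + 1) n y * coef (l + 1) (deriv f) n * h2
  -- A closed set inside (-1,1) cannot fill it, as it would then contain the endpoints.
  obtain ⟨y₀, hy₀, hy₀f⟩ : ∃ y₀ ∈ Ioo (-1 : ℝ) 1, y₀ ∉ tsupport f := by
    by_contra! hcon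
    have h1 : Icc (-1 : ℝ) 1 ⊆ tsupport f := by
      rw [← closure_Ioo (by norm_num)]
      exact closure_minimal hcon (isClosed_tsupport f)
    exact (hs (h1 ⟨by norm_num, le_rfl⟩)).2.false
  -- The term n = 0 is constant in y and is split off; the index shift then pairs degree n + 1 for l
  -- with degree n for l + 1.
  set T : ℝ → ℂ := fun y => ∑' n, kappa l (n + 1) * poly l (n + 1) y * coef l f (n + 1) with hT
  have hderiv : ∀ y ∈ Ioo (-1 : ℝ) 1, HasDerivAt T (deriv f y) y := fun y hy => by
    have h1 := hasDerivAt_tsum_of_isPreconnected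
      (summable_mul_norm_coef hl.add_one (polyBounded_kappa_mul hl.add_one hBp hB0)
        (fun n => mul_nonneg (norm_nonneg _) (hB0 n)) hf') isOpen_Ioo isPreconnected_Ioo
      (fun n y _ => hterm n y) (fun n y hy => by
        rw [norm_mul, norm_mul]
        gcongr
        exact hB n y (Ioo_subset_Icc_self hy)) hy
      ((summable_nat_add_iff 1).2 (hsum y hy)) hy
    rwa [(h _ hf'.1 (tsupport_deriv_subset.trans hs) y hy).tsum_eq] at h1
  have hconst : T y - f y = T y₀ - f y₀ := by
    have hd : ∀ y ∈ Ioo (-1 : ℝ) 1, HasDerivAt (fun y => T y - f y) 0 y := fun y hy => by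
      have h1 := (hderiv y hy).sub (hfa.hasDerivAt y)
      rwa [sub_self] at h1
    exact isOpen_Ioo.is_const_of_deriv_eq_zero isPreconnected_Ioo
      (fun y hy => (hd y hy).differentiableAt.differentiableWithinAt)
      (fun y hy => (hd y hy).deriv) hy hy₀
  have hp : ∀ x, poly l 0 x = 1 := fun x => by simp [poly, gegenbauer]
  have hsplit : ∀ y ∈ Ioo (-1 : ℝ) 1, ∑' n, kappa l n * poly l n y * coef l f n =
      kappa l 0 * coef l f 0 + T y := fun y hy => by
    rw [(hsum y hy).tsum_eq_zero_add, hp, mul_one]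
  have h0 := (hasSum_zero_of_notMem hl hf hs (Ioo_subset_Icc_self hy₀) hy₀f).tsum_eq
  rw [hsplit y₀ hy₀] at h0
  rw [image_eq_zero_of_notMem_tsupport hy₀f] at hconst
  have := (hsum y hy).hasSum
  rw [hsplit y hy] at this
  convert! this using 1
  linear_combination -hconst - h0

theorem hasExpansion (hl : Regular l) : HasExpansion l := by
  obtain ⟨N, hN⟩ := exists_nat_gt (1 / 2 - l.re)
  induction N generalizing l with
  | zero => exact hasExpansion_of_re hl (by simp at hN; linarith)
  | succ N ih =>
    refine HasExpansion.of_add_one hl (ih hl.add_one ?_)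
    push_cast at hN
    simp at hN ⊢
    linarith

end Gegenbauer

/-! ### Slices in two variables and passage to distributions -/

namespace Gegenbauer

variable {l : ℂ}

/-- The partial derivative in the first variable. -/
noncomputable def partialFst (F : ℝ × ℝ → ℂ) (p : ℝ × ℝ) : ℂ := fderiv ℝ F p (1, 0)

/-- The Gegenbauer operator in the first variable. -/
noncomputable def opFst (l : ℂ) (F : ℝ × ℝ → ℂ) (p : ℝ × ℝ) : ℂ :=
  (1 - (p.1 : ℂ) ^ 2) * partialFst (partialFst F) p - (2 * l + 1) * p.1 * partialFst F p

variable {F : ℝ × ℝ → ℂ}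

theorem contDiff_partialFst (hF : ContDiff ℝ (⊤ : ℕ∞) F) :
    ContDiff ℝ (⊤ : ℕ∞) (partialFst F) :=
  (hF.fderiv_right (m := (⊤ : ℕ∞)) (by simp)).clm_apply contDiff_const

theorem tsupport_partialFst_subset (F : ℝ × ℝ → ℂ) : tsupport (partialFst F) ⊆ tsupport F := by
  refine (closure_mono fun p hp => ?_).trans (tsupport_fderiv_subset ℝ)
  intro h
  exact hp (by rw [partialFst, h]; rfl)

theorem deriv_slice (hF : ContDiff ℝ (⊤ : ℕ∞) F) (y : ℝ) :
    deriv (fun x => F (x, y)) = fun x => partialFst F (x, y) := by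
  ext x
  have h1 : HasDerivAt (fun x : ℝ => (x, y)) (1, 0) x :=
    (hasDerivAt_id x).prodMk (hasDerivAt_const x y)
  exact ((hF.differentiable (by simp) (x, y)).hasFDerivAt.comp_hasDerivAt x h1).deriv

theorem op_slice (hF : ContDiff ℝ (⊤ : ℕ∞) F) (y : ℝ) :
    op l (fun x => F (x, y)) = fun x => opFst l F (x, y) := by
  ext x
  rw [op, deriv_slice hF, deriv_slice (contDiff_partialFst hF), opFst]

theorem contDiff_opFst (hF : ContDiff ℝ (⊤ : ℕ∞) F) : ContDiff ℝ (⊤ : ℕ∞) (opFst l F) := by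
  have h1 := contDiff_partialFst hF
  have h2 := contDiff_partialFst h1
  have hx : ContDiff ℝ (⊤ : ℕ∞) (fun p : ℝ × ℝ => (p.1 : ℂ)) :=
    Complex.ofRealCLM.contDiff.comp contDiff_fst
  exact ((contDiff_const.sub (hx.pow 2)).mul h2).sub ((contDiff_const.mul hx).mul h1)

theorem tsupport_opFst_subset (l : ℂ) (F : ℝ × ℝ → ℂ) : tsupport (opFst l F) ⊆ tsupport F := by
  refine closure_minimal (fun x hx => ?_) (isClosed_tsupport F)
  by_contra h
  have h1 : x ∉ tsupport (partialFst F) := fun h' => h (tsupport_partialFst_subset _ h')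
  have h2 : x ∉ tsupport (partialFst (partialFst F)) := fun h' =>
    h1 (tsupport_partialFst_subset _ h')
  exact hx (by simp [opFst, image_eq_zero_of_notMem_tsupport h1,
    image_eq_zero_of_notMem_tsupport h2])

theorem iterate_opFst (hF : ContDiff ℝ (⊤ : ℕ∞) F) (m : ℕ) :
    ContDiff ℝ (⊤ : ℕ∞) ((opFst l)^[m] F) ∧ tsupport ((opFst l)^[m] F) ⊆ tsupport F ∧
      ∀ y, (op l)^[m] (fun x => F (x, y)) = fun x => (opFst l)^[m] F (x, y) := by
  induction m with
  | zero => exact ⟨hF, le_rfl, fun y => rfl⟩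
  | succ m ih =>
    obtain ⟨h1, h2, h3⟩ := ih
    simp only [Function.iterate_succ_apply']
    exact ⟨contDiff_opFst h1, (tsupport_opFst_subset _ _).trans h2, fun y => by
      rw [h3, op_slice h1]⟩

theorem continuous_weight_fst_mul (a : ℂ) (hF : Continuous F)
    (hs : tsupport F ⊆ Ioo (-1 : ℝ) 1 ×ˢ Ioo (-1 : ℝ) 1) :
    Continuous (fun p : ℝ × ℝ => weight a p.1 * F p) := by
  refine continuous_of_tsupport fun p hp => ?_
  have hp : p ∈ tsupport F := tsupport_mul_subset_right hp
  have h1 : ContinuousAt (weight a) p.1 :=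
    continuousAt_weight (Or.inr (one_sub_sq_pos (hs hp).1).ne')
  exact (h1.comp continuousAt_fst).mul hF.continuousAt

theorem admissible_slice (hF : ContDiff ℝ (⊤ : ℕ∞) F)
    (hs : tsupport F ⊆ Ioo (-1 : ℝ) 1 ×ˢ Ioo (-1 : ℝ) 1) (y : ℝ) :
    ContDiff ℝ (⊤ : ℕ∞) (fun x => F (x, y)) ∧ tsupport (fun x => F (x, y)) ⊆ Ioo (-1 : ℝ) 1 :=
  ⟨hF.comp (contDiff_id.prodMk contDiff_const), fun _ hx =>
    (hs (tsupport_comp_subset_preimage F (f := fun x : ℝ => (x, y)) (by fun_prop) hx)).1⟩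

theorem exists_mass_slice_le (hF : Continuous F) (hc : HasCompactSupport F)
    (hs : tsupport F ⊆ Ioo (-1 : ℝ) 1 ×ˢ Ioo (-1 : ℝ) 1) :
    ∃ C, 0 ≤ C ∧ ∀ y, mass l (fun x => F (x, y)) ≤ C := by
  have hcont := continuous_weight_fst_mul (l - 1 / 2) hF hs
  obtain ⟨C, hC⟩ := hcont.bounded_above_of_compact_support hc.mul_left
  have hC0 : 0 ≤ C := (norm_nonneg _).trans (hC 0)
  refine ⟨2 * C, by positivity, fun y => ?_⟩
  have h1 : mass l (fun x => F (x, y)) ≤ ∫ _ in (-1 : ℝ)..1, C := by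
    refine intervalIntegral.integral_mono_on (by norm_num)
      (Continuous.intervalIntegrable ?_ _ _) intervalIntegrable_const fun x _ => hC (x, y)
    exact (hcont.comp (by fun_prop : Continuous fun x : ℝ => (x, y))).norm
  refine h1.trans (le_of_eq ?_)
  rw [intervalIntegral.integral_const, smul_eq_mul]
  norm_num

/-- The Gegenbauer weight is (1-x²)^m, whereas the term carries only (1-x²)^{m/2}; the excess is
compensated in the test function. At x = y the compensating factors cancel, so the limit is
unaffected. -/
theorem integral_closureTerm {m : ℂ} (hl : Regular (m + 1 / 2)) (n : ℕ) {y : ℝ}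
    (hy : y ∈ Ioo (-1 : ℝ) 1) (f : ℝ → ℂ) :
    ∫ x in Ioo (-1 : ℝ) 1, closureTerm m n x y * f x =
      kappa (m + 1 / 2) n * poly (m + 1 / 2) n y *
        coef (m + 1 / 2) (fun x => weight (-(m / 2)) x * weight (m / 2) y * f x) n := by
  rw [coef, intervalIntegral.integral_of_le (by norm_num), integral_Ioc_eq_integral_Ioo,
    ← integral_const_mul]
  refine setIntegral_congr_fun measurableSet_Ioo fun x hx => ?_
  have h : weight (m + 1 / 2 - 1 / 2) x * weight (-(m / 2)) x = weight (m / 2) x := by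
    rw [← weight_add _ _ hx]; congr 1; ring
  rw [closureTerm_eq hl n hx hy]
  linear_combination (-kappa (m + 1 / 2) n * poly (m + 1 / 2) n y * poly (m + 1 / 2) n x *
    weight (m / 2) y * f x) * h

theorem weight_neg_mul (a : ℂ) {x : ℝ} (hx : x ∈ Ioo (-1 : ℝ) 1) :
    weight (-a) x * weight a x = 1 := by
  rw [← weight_add _ _ hx, neg_add_cancel, weight, Complex.cpow_zero]

theorem continuousOn_weight (a : ℂ) : ContinuousOn (weight a) (Ioo (-1 : ℝ) 1) := fun _ hx =>
  (continuousAt_weight (Or.inr (one_sub_sq_pos hx).ne')).continuousWithinAt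

theorem continuousOn_closureTerm {m : ℂ} (hl : Regular (m + 1 / 2)) (n : ℕ) :
    ContinuousOn (fun p : ℝ × ℝ => closureTerm m n p.1 p.2)
      (Ioo (-1 : ℝ) 1 ×ˢ Ioo (-1 : ℝ) 1) := by
  have h1 : ContinuousOn (fun p : ℝ × ℝ => weight (m / 2) p.1)
      (Ioo (-1 : ℝ) 1 ×ˢ Ioo (-1 : ℝ) 1) :=
    (continuousOn_weight _).comp continuousOn_fst fun p hp => hp.1
  have h2 : ContinuousOn (fun p : ℝ × ℝ => weight (m / 2) p.2)
      (Ioo (-1 : ℝ) 1 ×ˢ Ioo (-1 : ℝ) 1) :=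
    (continuousOn_weight _).comp continuousOn_snd fun p hp => hp.2
  have cp := continuous_poly (m + 1 / 2) n
  refine ContinuousOn.congr (f := fun p : ℝ × ℝ =>
    kappa (m + 1 / 2) n * poly (m + 1 / 2) n p.2 *
      (poly (m + 1 / 2) n p.1 * (weight (m / 2) p.1 * weight (m / 2) p.2)))
    (by fun_prop) fun p hp => closureTerm_eq hl n hp.1 hp.2

theorem regular_of_ne {m : ℂ} (hm : ∀ k : ℕ, 2 * m + 1 ≠ -(k : ℂ)) : Regular (m + 1 / 2) :=
  fun n h => hm n (by linear_combination h)

theorem hasSumInDistributions_diracAt {m : ℂ} (hl : Regular (m + 1 / 2)) {y : ℝ}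
    (hy : y ∈ Ioo (-1 : ℝ) 1) :
    HasSumInDistributions openInterval11 (fun n x => closureTerm m n x y) (diracAt y) := by
  refine ⟨fun n => ?_, fun φ => ?_⟩
  · refine ContinuousOn.locallyIntegrableOn ?_ measurableSet_Ioo
    exact (continuousOn_closureTerm hl n).comp (f := fun x : ℝ => (x, y)) (by fun_prop)
      fun x hx => ⟨hx, hy⟩
  · have hs : tsupport φ ⊆ Ioo (-1 : ℝ) 1 := φ.tsupport_subset
    set f : ℝ → ℂ := fun x => weight (-(m / 2)) x * weight (m / 2) y * φ x with hf
    have hfs : tsupport f ⊆ tsupport φ := tsupport_mul_subset_right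
    have hfc : ContDiff ℝ (⊤ : ℕ∞) f := contDiff_of_contDiffAt_tsupport fun x hx =>
      ((contDiffAt_weight _ (hs (hfs hx))).mul contDiffAt_const).mul φ.contDiff.contDiffAt
    have h := hasExpansion hl f hfc (hfs.trans hs) y hy
    have hval : f y = φ y := by
      rw [hf]
      simp only
      rw [weight_neg_mul _ hy, one_mul]
    rw [hval] at h
    exact h.congr_fun fun n => integral_closureTerm hl n hy φ

theorem hasSumInDistributions_diracDiagonal {m : ℂ} (hl : Regular (m + 1 / 2)) :
    HasSumInDistributions openSquare11 (fun n p => closureTerm m n p.1 p.2) diracDiagonal := by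
  refine ⟨fun n => ContinuousOn.locallyIntegrableOn (continuousOn_closureTerm hl n)
    (measurableSet_Ioo.prod measurableSet_Ioo), fun Φ => ?_⟩
  have hs : tsupport Φ ⊆ Ioo (-1 : ℝ) 1 ×ˢ Ioo (-1 : ℝ) 1 := Φ.tsupport_subset
  set l := m + 1 / 2 with hldef
  set F : ℝ × ℝ → ℂ := fun p => weight (-(m / 2)) p.1 * weight (m / 2) p.2 * Φ p with hF
  have hFs : tsupport F ⊆ tsupport Φ := tsupport_mul_subset_right
  have hFS := hFs.trans hs
  have hFcs : HasCompactSupport F := Φ.hasCompactSupport.mul_left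
  have hFc : ContDiff ℝ (⊤ : ℕ∞) F := contDiff_of_contDiffAt_tsupport fun p hp =>
    (((contDiffAt_weight _ (hFS hp).1).comp p contDiffAt_fst).mul
      ((contDiffAt_weight _ (hFS hp).2).comp p contDiffAt_snd)).mul Φ.contDiff.contDiffAt
  have hadm : ∀ y, Admissible l (fun x => F (x, y)) := fun y =>
    ⟨(admissible_slice hFc hFS y).1, Or.inr (admissible_slice hFc hFS y).2⟩
  obtain ⟨B, hBp, hB0, hB⟩ := exists_bound l
  obtain ⟨k, D, hD, hdecay⟩ := exists_decay hl (polyBounded_kappa_mul hl hBp hB0)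
  obtain ⟨hkc, hks, hk⟩ := iterate_opFst (l := l) hFc k
  obtain ⟨C₁, hC₁, h₁⟩ := exists_mass_slice_le (l := l) hFc.continuous hFcs hFS
  obtain ⟨C₂, hC₂, h₂⟩ := exists_mass_slice_le (l := l) hkc.continuous
    (hFcs.of_isClosed_subset (isClosed_tsupport _) hks) (hks.trans hFS)
  set ν : Measure ℝ := volume.restrict (Ioo (-1 : ℝ) 1) with hν
  have hint : ∀ n, Integrable (fun p : ℝ × ℝ => closureTerm m n p.1 p.2 * Φ p) (ν.prod ν) := by
    intro n
    rw [hν, Measure.prod_restrict]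
    have cp := continuous_poly l n
    have cw := continuous_weight_fst_mul m hFc.continuous hFS
    have hG : Integrable (fun p : ℝ × ℝ => kappa l n * poly l n p.2 * poly l n p.1 *
        (weight m p.1 * F p)) (volume.prod volume) :=
      Continuous.integrable_of_hasCompactSupport (by fun_prop) hFcs.mul_left.mul_left
    refine hG.integrableOn.congr_fun (fun p hp => ?_) (measurableSet_Ioo.prod measurableSet_Ioo)
    have h : weight m p.1 * weight (-(m / 2)) p.1 = weight (m / 2) p.1 := by
      rw [← weight_add _ _ hp.1]; congr 1; ring
    simp only
    rw [closureTerm_eq hl n hp.1 hp.2, hF]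
    simp only
    linear_combination (kappa l n * poly l n p.2 * poly l n p.1 * weight (m / 2) p.2 * Φ p) * h
  have hinner : ∀ n, ∀ y ∈ Ioo (-1 : ℝ) 1, ∫ x, closureTerm m n x y * Φ (x, y) ∂ν =
      kappa l n * poly l n y * coef l (fun x => F (x, y)) n := fun n y hy =>
    integral_closureTerm hl n hy fun x => Φ (x, y)
  have hval : ∀ y ∈ Ioo (-1 : ℝ) 1, F (y, y) = Φ (y, y) := fun y hy => by
    rw [hF]
    simp only
    rw [weight_neg_mul _ hy, one_mul]
  -- The inner integral over x is the expansion of the slice F(·, y) at y. The masses of all slices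
  -- of F and of its k-th `opFst` iterate are bounded by C₁ and C₂, so the dominating sequence is
  -- independent of y.
  have key := hasSum_integral_of_dominated_convergence (μ := ν)
    (F := fun n y => ∫ x, closureTerm m n x y * Φ (x, y) ∂ν) (f := fun y => Φ (y, y))
    (fun n _ => D * (C₁ + C₂) * (1 / ((n : ℝ) + 1) ^ 2))
    (fun n => (hint n).integral_prod_right.aestronglyMeasurable)
    (fun n => (ae_restrict_iff' measurableSet_Ioo).2 (Filter.Eventually.of_forall fun y hy => ?_))
    (Filter.Eventually.of_forall fun y => summable_one_div_add_one_sq.mul_left _)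
    (integrable_const _)
    ((ae_restrict_iff' measurableSet_Ioo).2 (Filter.Eventually.of_forall fun y hy => ?_))
  · refine key.congr_fun fun n => ?_
    rw [← integral_prod_symm _ (hint n), hν, Measure.prod_restrict]
    rfl
  · rw [hinner n y hy, norm_mul, norm_mul]
    calc ‖kappa l n‖ * ‖poly l n y‖ * ‖coef l (fun x => F (x, y)) n‖
        ≤ ‖kappa l n‖ * B n * ‖coef l (fun x => F (x, y)) n‖ := by
          gcongr
          exact hB n y (Ioo_subset_Icc_self hy)
      _ ≤ _ := hdecay _ (hadm y) n
      _ ≤ _ := by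
          rw [hk y]
          gcongr
          · exact h₁ y
          · exact h₂ y
  · have h := hasExpansion hl _ (admissible_slice hFc hFS y).1 (admissible_slice hFc hFS y).2 y hy
    rw [hval y hy] at h
    exact h.congr_fun fun n => hinner n y hy

end Gegenbauer

theorem mainTheorem5 (μ : ℂ) (hμ : ∀ m : ℕ, 2 * μ + 1 ≠ -(m : ℂ)) :
    (∀ x' ∈ openInterval11,
      HasSumInDistributions openInterval11 (fun n x => closureTerm μ n x x') (diracAt x')) ∧
    HasSumInDistributions openSquare11
      (fun n p => closureTerm μ n p.1 p.2) diracDiagonal :=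
  ⟨fun _ hx' => Gegenbauer.hasSumInDistributions_diracAt (Gegenbauer.regular_of_ne hμ) hx',
    Gegenbauer.hasSumInDistributions_diracDiagonal (Gegenbauer.regular_of_ne hμ)⟩
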